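/- **Theorem 2 (double-chain algorithm, Markov sampling, constant stepsize).** *Setting.* Let $(S,A,P_{\rm env},r)$ be a finite Markov decision process, $\pi$ a fixed policy, $P(s'\mid s)=\sum_a P_{\rm env}(s'\mid s,a)\pi(a\mid s)$, $r_s=\sum_a\pi(a\mid s)r(s,a)$, $R=(r_s)_{s\in S}$ and $r_{\max}=\max_{s,a}|r(s,a)|$. Assume that $P$ is irreducible and aperiodic, with stationary distribution $\mu$; write $D=\mathrm{diag}(\mu)$, $e$ for the all-ones vector and $\Pi=I-e\mu^\top$. Let $\Phi\in\mathbb R^{S\times d}$, $d\ge1$, have linearly independent columns and rows $\phi(s)^\top$ with $\|\phi(s)\|\le1$ (Euclidean norm). Put $$\eta=\min_{\|x\|=1}\Big\{\tfrac12\sum_{s,s'}\mu(s)P(s'\mid s)\big((\Phi x)(s)-(\Phi x)(s')\big)^2+(\mu^\top\Phi x)^2\Big\},$$ and let $\theta^*$ be the solution of $\Phi^\top D(I-\Pi P)\Phi\theta^*=\Phi^\top D\Pi R$. For $\alpha>0$ let $\tau_{\rm mix}(\alpha)=\min\{\tau\ge 0:\ \|p_\tau(\cdot\mid s)-\mu\|_1\le\alpha\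 \text{for all } s\}$, where $p_\tau(\cdot\mid s)$ is the law of the chain after $\tau$ steps from $s$. Let $(s_t)$ and $(\hat s_t)$ be two independent Markov chains with transition matrix $P$ (arbitrary initial laws), let $\theta_0\in\mathbb R^d$ be deterministic, and with a constant stepsize $\alpha$ let $$\theta_{t+1}=\theta_t+\alpha\Big(-(r_{s_t}+\phi(s_t)^\top\theta_t)\,\phi(\hat s_t)+\big(r_{s_t}+\phi(s_{t+1})^\top\theta_t-\phi(s_t)^\top\theta_t\big)\phi(s_t)\Big).$$ Let $B=2\|\theta_0-\theta^*\|+r_{\max}+\|\theta^*\|$ and $G=42B^2+30(r_{\max}+\|\theta^*\|)^2$. *Claims.* 1. If $\alpha>0$, $\tau_{\rm mix}=\tau_{\rm mix}(\alpha)$ and $\alpha\le\dfrac{\eta B^2}{(3\tau_{\rm mix}+1)G}$, then for all $T\ge\tau_{\rm mix}$ $$\mathbb E\|\theta_T-\theta^*\|^2\le e^{-2\alpha\eta(T-\tau_{\rm mix})}B^2+\frac{\alpha G(3\tau_{\rm mix}+1)}{2\eta}.$$ 2. There are $C>1$ and $\beta\in[0,1)$ with $\|p_\tau(\cdot\mid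 s)-\mu\|_1\le C\beta^\tau$ for all $\tau\ge0$ and $s\in S$. For any such $C,\beta$ put $L=\max\{1,(\log C+1)/\log(1/\beta)\}$ (with $L=1$ if $\beta=0$). The stepsize $\alpha=\log T/(\eta T)$ then yields the rate $\tilde O(1/T)$ and the sample complexity $\tilde O(\varepsilon^{-1}\eta^{-2})$ in the following sense, with an absolute constant $K>0$ (independent of the decision process, the policy, the features, $d$, $\theta_0$, $C$, $\beta$, $T$ and $\varepsilon$): - for every integer $T\ge2$ with $T\ge K L\eta^{-2}\log^2T$, $$\mathbb E\|\theta_T-\theta^*\|^2\le K\,\frac{G\,L}{\eta^2}\cdot\frac{\log^2T}{T};$$ - for every $\varepsilon\in(0,1]$, with $N=(1+G)L\,\varepsilon^{-1}\eta^{-2}$, every integer $T\ge K\,N\log^2(2+N)$ satisfies $\mathbb E\|\theta_T-\theta^*\|^2\le\varepsilon$. -/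

import Mathlib

open MeasureTheory ProbabilityTheory Matrix

noncomputable section

namespace AvgRewardTD

/-- A finite Markov decision process `(S, A, P_env, r)`. -/
structure MDP (S A : Type*) [Fintype S] where
  /-- `trans s a s'` is the probability `P_env(s' ∣ s, a)`. -/
  trans : S → A → S → ℝ
  trans_mem : ∀ s a, trans s a ∈ stdSimplex ℝ S
  /-- The reward function `r(s, a)`. -/
  reward : S → A → ℝ

/-- A (randomized, stationary) policy; `prob s a` is `π(a ∣ s)`. -/
structure Policy (S A : Type*) [Fintype A] where
  prob : S → A → ℝ
  prob_mem : ∀ s, prob s ∈ stdSimplex ℝ A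

section MDP

variable {S A : Type*} [Fintype S] [Fintype A]

/-- `r_max = max_{s,a} |r(s,a)|`. -/
def MDP.rMax (M : MDP S A) : ℝ := ⨆ p : S × A, |M.reward p.1 p.2|

/-- The transition matrix induced by the policy: the entry `(s, s')` is `P(s' ∣ s)`. -/
def MDP.transMatrix (M : MDP S A) (π : Policy S A) : Matrix S S ℝ :=
  Matrix.of fun s s' => ∑ a, M.trans s a s' * π.prob s a

/-- The vector `R` of expected rewards `r_s = ∑_a π(a ∣ s) r(s,a)`. -/
def MDP.expReward (M : MDP S A) (π : Policy S A) : S → ℝ :=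
  fun s => ∑ a, π.prob s a * M.reward s a

end MDP

section Chain

variable {S : Type*} [Fintype S]

/-- `μ` is a stationary distribution of the transition matrix `P`. -/
def IsStationary (P : Matrix S S ℝ) (μ : S → ℝ) : Prop :=
  μ ∈ stdSimplex ℝ S ∧ μ ᵥ* P = μ

/-- Every state has period one: the return times `{n ≥ 1 : P^n(s,s) > 0}` have gcd `1`. -/
def IsAperiodic [DecidableEq S] (P : Matrix S S ℝ) : Prop :=
  ∀ s, Nat.setGcd {n : ℕ | 0 < n ∧ 0 < (P ^ n) s s} = 1

/-- The `ℓ¹` distance `‖p_τ(· ∣ s) - μ‖₁` of the law after `τ` steps from `s` to `μ`. -/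
def l1Dist [DecidableEq S] (P : Matrix S S ℝ) (μ : S → ℝ) (τ : ℕ) (s : S) : ℝ :=
  ∑ s', |(P ^ τ) s s' - μ s'|

/-- The mixing time `τ_mix(ε) = min {τ : max_s ‖p_τ(· ∣ s) - μ‖₁ ≤ ε}`. -/
def mixingTime [DecidableEq S] (P : Matrix S S ℝ) (μ : S → ℝ) (ε : ℝ) : ℕ :=
  sInf {τ : ℕ | ∀ s, l1Dist P μ τ s ≤ ε}

/-- `C` and `β` are constants of geometric mixing: `C > 1`, `β ∈ [0,1)` and
`‖p_τ(· ∣ s) - μ‖₁ ≤ C β^τ` for all `τ` and `s`. -/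
def IsGeometricMixing [DecidableEq S] (P : Matrix S S ℝ) (μ : S → ℝ) (C β : ℝ) : Prop :=
  1 < C ∧ 0 ≤ β ∧ β < 1 ∧ ∀ (τ : ℕ) (s : S), l1Dist P μ τ s ≤ C * β ^ τ

/-- The mixing factor `L = max {1, (log C + 1) / log (1/β)}`, read as `1` for `β = 0`. -/
def mixingFactor (C β : ℝ) : ℝ := max 1 ((Real.log C + 1) / Real.log (1 / β))

/-- The squared Dirichlet seminorm `½ ∑_{s,s'} μ(s) P(s' ∣ s) (f(s) - f(s'))²`. -/
def dirichletSq (P : Matrix S S ℝ) (μ f : S → ℝ) : ℝ :=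
  (1 / 2) * ∑ s, ∑ s', μ s * P s s' * (f s - f s') ^ 2

/-- Under the probability measure `Q`, the process `X` is a time-homogeneous Markov chain
with transition matrix `P` (the initial law is arbitrary). -/
def IsMarkovChain {Ω : Type*} [MeasurableSpace Ω] [MeasurableSpace S]
    (Q : Measure Ω) (P : Matrix S S ℝ) (X : ℕ → Ω → S) : Prop :=
  (∀ t, Measurable (X t)) ∧
    ∀ (t : ℕ) (x : ℕ → S),
      Q.real {ω | ∀ i ≤ t + 1, X i ω = x i}
        = Q.real {ω | ∀ i ≤ t, X i ω = x i} * P (x t) (x (t + 1))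

end Chain

section Algorithm

variable {S : Type*} [Fintype S] {d : ℕ}

/-- The feature vector `φ(s)`, i.e. the `s`-th row of the feature matrix. -/
def feature (Φ : Matrix S (Fin d) ℝ) (s : S) : EuclideanSpace ℝ (Fin d) :=
  WithLp.toLp 2 (Φ s)

/-- The condition number `η = min_{‖x‖ = 1} ‖Φ x‖_Dir² + (μᵀ Φ x)²`. -/
def conditionNumber (P : Matrix S S ℝ) (μ : S → ℝ) (Φ : Matrix S (Fin d) ℝ) : ℝ :=
  ⨅ x : Metric.sphere (0 : EuclideanSpace ℝ (Fin d)) 1,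
    dirichletSq P μ (Φ *ᵥ x.1.ofLp) + (μ ⬝ᵥ (Φ *ᵥ x.1.ofLp)) ^ 2

/-- The projection `Π = I - e μᵀ`. -/
def centering [DecidableEq S] (μ : S → ℝ) : Matrix S S ℝ :=
  1 - Matrix.vecMulVec (fun _ => 1) μ

/-- `θ` solves `Φᵀ D (I - Π P) Φ θ = Φᵀ D Π R`, where `D = diag(μ)`. -/
def IsFixedPoint [DecidableEq S] (P : Matrix S S ℝ) (μ R : S → ℝ) (Φ : Matrix S (Fin d) ℝ)
    (θ : EuclideanSpace ℝ (Fin d)) : Prop :=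
  (Φᵀ * Matrix.diagonal μ * (1 - centering μ * P) * Φ) *ᵥ θ.ofLp
    = (Φᵀ * Matrix.diagonal μ * centering μ) *ᵥ R

/-- `f(s, ŝ, θ) = -(r_s + φ(s)ᵀ θ) φ(ŝ)`. -/
def fUpdate (R : S → ℝ) (Φ : Matrix S (Fin d) ℝ) (s sHat : S)
    (θ : EuclideanSpace ℝ (Fin d)) : EuclideanSpace ℝ (Fin d) :=
  -((R s + inner ℝ (feature Φ s) θ) • feature Φ sHat)

/-- `g(s, s', θ) = (r_s + φ(s')ᵀ θ - φ(s)ᵀ θ) φ(s)`. -/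
def gUpdate (R : S → ℝ) (Φ : Matrix S (Fin d) ℝ) (s s' : S)
    (θ : EuclideanSpace ℝ (Fin d)) : EuclideanSpace ℝ (Fin d) :=
  (R s + inner ℝ (feature Φ s') θ - inner ℝ (feature Φ s) θ) • feature Φ s

/-- The double-chain iterates `θ_t` with stepsizes `α_t`, along the two state trajectories
`s` and `sHat`; the successor `s_t'` of `s_t` is the next state `s_{t+1}` of the first chain. -/
def doubleChain (R : S → ℝ) (Φ : Matrix S (Fin d) ℝ) (α : ℕ → ℝ)
    (θ₀ : EuclideanSpace ℝ (Fin d)) (s sHat : ℕ → S) : ℕ → EuclideanSpace ℝ (Fin d)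
  | 0 => θ₀
  | t + 1 =>
    let θ := doubleChain R Φ α θ₀ s sHat t
    θ + α t • (fUpdate R Φ (s t) (sHat t) θ + gUpdate R Φ (s t) (s (t + 1)) θ)

/-- `B = 2 ‖θ₀ - θ*‖ + r_max + ‖θ*‖`. -/
def constB (rMax : ℝ) (θ₀ θstar : EuclideanSpace ℝ (Fin d)) : ℝ :=
  2 * ‖θ₀ - θstar‖ + rMax + ‖θstar‖

/-- `G = 42 B² + 30 (r_max + ‖θ*‖)²`. -/
def constG (rMax : ℝ) (θ₀ θstar : EuclideanSpace ℝ (Fin d)) : ℝ :=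
  42 * constB rMax θ₀ θstar ^ 2 + 30 * (rMax + ‖θstar‖) ^ 2

/-- The mean square error `E ‖θ_T - θ*‖²` of the double-chain algorithm with constant
stepsize `α`, driven by the random trajectories `s` and `sHat`. -/
def meanSqError {Ω : Type*} [MeasurableSpace Ω] (Q : Measure Ω) (R : S → ℝ)
    (Φ : Matrix S (Fin d) ℝ) (α : ℝ) (θ₀ θstar : EuclideanSpace ℝ (Fin d))
    (s sHat : ℕ → Ω → S) (T : ℕ) : ℝ :=
  ∫ ω, ‖doubleChain R Φ (fun _ => α) θ₀ (fun t => s t ω) (fun t => sHat t ω) T - θstar‖ ^ 2 ∂Q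

end Algorithm

end AvgRewardTD

end

/-!
Since the two chains are independent, the pairs `(s_t, ŝ_t)` form a Markov chain with kernel
`P ⊗ P` and stationary law `μ ⊗ μ`. Averaged over a stationary edge of this chain, the update is
an affine field vanishing at `θ*` whose linear part `x ↦ -A x` satisfies
`⟪x, A x⟫ = ‖Φ x‖²_Dir + (μᵀ Φ x)² ≥ η ‖x‖²`, so the algorithm is a dissipative stochastic
approximation with `3`-Lipschitz updates. The bias of its Markovian noise is controlled by
conditioning on the past `τ = τ_mix` steps back: the chain has nearly forgotten that state, while
the iterate has moved by `O(α τ)` only. The mean square errors `E_t` therefore satisfy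
`E_{t+1} ≤ (1 - 2 α η) E_t + α² (3 τ + 1) G` for `t ≥ τ` as long as the earlier errors are at
most `B²`, and the condition on the stepsize propagates this bound. For `α = log T / (η T)` the
mixing time is of order `L log T`, which gives the rate and the sample complexity.
-/

noncomputable section

namespace AvgRewardTD

section Stochastic

variable {S : Type*} [Fintype S] [DecidableEq S]

lemma MDP.transMatrix_mem_rowStochastic {A : Type*} [Fintype A] (M : MDP S A)
    (π : Policy S A) : M.transMatrix π ∈ rowStochastic ℝ S := by
  refine mem_rowStochastic_iff_sum.2 ⟨fun s s' => Finset.sum_nonneg fun a _ =>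
    mul_nonneg ((M.trans_mem s a).1 s') ((π.prob_mem s).1 a), fun s => ?_⟩
  simp only [MDP.transMatrix, Matrix.of_apply]
  rw [Finset.sum_comm]
  simp_rw [← Finset.sum_mul, (M.trans_mem s _).2, one_mul]
  exact (π.prob_mem s).2

lemma sum_pow_row {P : Matrix S S ℝ} (hP : P ∈ rowStochastic ℝ S) (n : ℕ) (s : S) :
    ∑ s', (P ^ n) s s' = 1 :=
  sum_row_of_mem_rowStochastic (pow_mem hP n) s

lemma pow_add_pos {A : Matrix S S ℝ} (hA : ∀ i j, 0 ≤ A i j) {m n : ℕ} {i j k : S}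
    (hm : 0 < (A ^ m) i j) (hn : 0 < (A ^ n) j k) : 0 < (A ^ (m + n)) i k := by
  rw [pow_add, Matrix.mul_apply]
  exact Finset.sum_pos'
    (fun u _ => mul_nonneg (pow_apply_nonneg hA m i u) (pow_apply_nonneg hA n u k))
    ⟨j, Finset.mem_univ _, mul_pos hm hn⟩

lemma IsAperiodic.exists_forall_ge_pow_pos {A : Matrix S S ℝ} (hA : ∀ i j, 0 ≤ A i j)
    (hap : IsAperiodic A) (s : S) : ∃ n, ∀ m ≥ n, 0 < (A ^ m) s s := by
  obtain ⟨n, hn⟩ := Nat.exists_mem_closure_of_ge {n : ℕ | 0 < n ∧ 0 < (A ^ n) s s}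
  refine ⟨n, fun m hm => ?_⟩
  exact AddSubmonoid.closure_induction (motive := fun m _ => 0 < (A ^ m) s s) (fun _ h => h.2)
    (by simp) (fun _ _ _ _ ha hb => pow_add_pos hA ha hb) (hn m hm (by rw [hap s]; simp))

lemma IsAperiodic.isPrimitive {A : Matrix S S ℝ} (hap : IsAperiodic A) (hirr : A.IsIrreducible) :
    A.IsPrimitive := by
  choose n hn using hap.exists_forall_ge_pow_pos hirr.nonneg
  choose k _ hk using (isIrreducible_iff_exists_pow_pos hirr.nonneg).1 hirr
  refine ⟨hirr.nonneg, (∑ s, n s) + (∑ s, ∑ s', k s s') + 1, by omega, fun i j => ?_⟩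
  have hni : n i ≤ ∑ s, n s := Finset.single_le_sum (fun _ _ => Nat.zero_le _) (Finset.mem_univ i)
  have hkij : k i j ≤ ∑ s, ∑ s', k s s' :=
    (Finset.single_le_sum (f := k i) (fun _ _ => Nat.zero_le _) (Finset.mem_univ j)).trans
      (Finset.single_le_sum (f := fun s => ∑ s', k s s') (fun _ _ => Nat.zero_le _)
        (Finset.mem_univ i))
  obtain ⟨m, hm⟩ := Nat.exists_eq_add_of_le'
    (show k i j ≤ (∑ s, n s) + (∑ s, ∑ s', k s s') + 1 by omega)
  rw [hm]
  exact pow_add_pos hirr.nonneg (hn i m (by omega)) (hk i j)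

lemma IsStationary.vecMul_pow {P : Matrix S S ℝ} {μ : S → ℝ} (hμ : IsStationary P μ) (n : ℕ) :
    μ ᵥ* (P ^ n) = μ := by
  induction n with
  | zero => simp
  | succ n ih => rw [pow_succ, ← Matrix.vecMul_vecMul, ih, hμ.2]

lemma exists_pos_of_mem_stdSimplex {ι : Type*} [Fintype ι] {p : ι → ℝ} (hp : p ∈ stdSimplex ℝ ι) :
    ∃ i, 0 < p i := by
  obtain ⟨i, -, hi⟩ := Finset.exists_ne_zero_of_sum_ne_zero (hp.2.trans_ne one_ne_zero)
  exact ⟨i, (hp.1 i).lt_of_ne' hi⟩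

end Stochastic

section Mixing

variable {S : Type*} [Fintype S] [DecidableEq S] {P : Matrix S S ℝ} {μ : S → ℝ}

lemma l1Dist_le_two (hP : P ∈ rowStochastic ℝ S) (hμ : μ ∈ stdSimplex ℝ S) (τ : ℕ) (s : S) :
    l1Dist P μ τ s ≤ 2 := by
  calc l1Dist P μ τ s ≤ ∑ s', ((P ^ τ) s s' + μ s') := by
        refine Finset.sum_le_sum fun s' _ => (abs_sub _ _).trans_eq ?_
        rw [abs_of_nonneg (nonneg_of_mem_rowStochastic (pow_mem hP τ)), abs_of_nonneg (hμ.1 s')]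
    _ = 2 := by rw [Finset.sum_add_distrib, sum_pow_row hP, hμ.2, one_add_one_eq_two]

-- Subtracting the common part `δ μ` from the rows of `P ^ n` does not change the difference of
-- the two laws and leaves a nonnegative matrix with row sums `1 - δ`.
lemma l1Dist_add_le (hP : P ∈ rowStochastic ℝ S) (hμ : IsStationary P μ) {n : ℕ} {δ : ℝ}
    (hδ : ∀ i j, δ * μ j ≤ (P ^ n) i j) (τ : ℕ) (s : S) :
    l1Dist P μ (τ + n) s ≤ (1 - δ) * l1Dist P μ τ s := by
  have hdiff : ∀ s', (P ^ (τ + n)) s s' - μ s'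
      = ∑ u, ((P ^ τ) s u - μ u) * ((P ^ n) u s' - δ * μ s') := by
    intro s'
    have hstat : ∑ u, μ u * (P ^ n) u s' = μ s' := congrFun (hμ.vecMul_pow n) s'
    have hmass : ∑ u, ((P ^ τ) s u - μ u) = 0 := by
      rw [Finset.sum_sub_distrib, sum_pow_row hP, hμ.1.2, sub_self]
    simp_rw [mul_sub, Finset.sum_sub_distrib, ← Finset.sum_mul, hmass, sub_mul,
      Finset.sum_sub_distrib, hstat, pow_add, Matrix.mul_apply]
    ring
  calc l1Dist P μ (τ + n) s
      ≤ ∑ s', ∑ u, |(P ^ τ) s u - μ u| * ((P ^ n) u s' - δ * μ s') := by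
        refine Finset.sum_le_sum fun s' _ => ?_
        rw [hdiff]
        refine (Finset.abs_sum_le_sum_abs _ _).trans (Finset.sum_le_sum fun u _ => ?_)
        rw [abs_mul, abs_of_nonneg (sub_nonneg.2 (hδ u s'))]
    _ = ∑ u, |(P ^ τ) s u - μ u| * (1 - δ) := by
        rw [Finset.sum_comm]
        refine Finset.sum_congr rfl fun u _ => ?_
        rw [← Finset.mul_sum, Finset.sum_sub_distrib, ← Finset.mul_sum, sum_pow_row hP, hμ.1.2,
          mul_one]
    _ = (1 - δ) * l1Dist P μ τ s := by
        rw [← Finset.sum_mul, mul_comm]; rfl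

lemma exists_minorization (hprim : P.IsPrimitive) (hμ : μ ∈ stdSimplex ℝ S) :
    ∃ n > 0, ∃ δ > 0, δ < 1 ∧ ∀ i j, δ * μ j ≤ (P ^ n) i j := by
  obtain ⟨n, hn, hpos⟩ := hprim.exists_pos_pow
  obtain ⟨u, -⟩ := exists_pos_of_mem_stdSimplex hμ
  have : Nonempty S := ⟨u⟩
  obtain ⟨p, hp⟩ := Finite.exists_min fun p : S × S => (P ^ n) p.1 p.2
  refine ⟨n, hn, min ((P ^ n) p.1 p.2) (1 / 2), lt_min (hpos _ _) one_half_pos,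
    (min_le_right _ _).trans_lt one_half_lt_one, fun i j => ?_⟩
  have hμj : μ j ≤ 1 := hμ.2 ▸ Finset.single_le_sum (fun i _ => hμ.1 i) (Finset.mem_univ j)
  calc min ((P ^ n) p.1 p.2) (1 / 2) * μ j ≤ (P ^ n) p.1 p.2 * 1 :=
        mul_le_mul (min_le_left _ _) hμj (hμ.1 j) (hpos _ _).le
    _ ≤ (P ^ n) i j := (mul_one _).trans_le (hp (i, j))

lemma l1Dist_add_mul_le (hP : P ∈ rowStochastic ℝ S) (hμ : IsStationary P μ) {n : ℕ} {δ : ℝ}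
    (hδ1 : δ ≤ 1) (hδ : ∀ i j, δ * μ j ≤ (P ^ n) i j) (r q : ℕ) (s : S) :
    l1Dist P μ (r + n * q) s ≤ (1 - δ) ^ q * 2 := by
  induction q with
  | zero => simpa using l1Dist_le_two hP hμ.1 r s
  | succ q ih =>
    calc l1Dist P μ (r + n * (q + 1)) s ≤ (1 - δ) * l1Dist P μ (r + n * q) s := by
          rw [Nat.mul_succ, ← add_assoc]; exact l1Dist_add_le hP hμ hδ _ s
      _ ≤ (1 - δ) ^ (q + 1) * 2 := by
          rw [pow_succ', mul_assoc]; exact mul_le_mul_of_nonneg_left ih (sub_nonneg.2 hδ1)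

-- A contraction by `γ` every `n` steps amounts to a contraction by `β = γ ^ (1 / n)` per step; the
-- incomplete last block costs the factor `γ⁻¹`.
lemma exists_pow_div_le {γ : ℝ} (hγ0 : 0 < γ) (hγ1 : γ < 1) {n : ℕ} (hn : 0 < n) :
    ∃ β : ℝ, 0 ≤ β ∧ β < 1 ∧ ∀ τ : ℕ, γ ^ (τ / n) ≤ γ⁻¹ * β ^ τ := by
  have hβ0 : 0 < γ ^ ((n : ℝ)⁻¹) := Real.rpow_pos_of_pos hγ0 _
  have hβ1 : γ ^ ((n : ℝ)⁻¹) < 1 := Real.rpow_lt_one hγ0.le hγ1 (by positivity)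
  have hβn : (γ ^ ((n : ℝ)⁻¹)) ^ n = γ := Real.rpow_inv_natCast_pow hγ0.le hn.ne'
  refine ⟨γ ^ ((n : ℝ)⁻¹), hβ0.le, hβ1, fun τ => ?_⟩
  rw [inv_mul_eq_div, le_div_iff₀ hγ0, ← pow_succ]
  nth_rw 1 [← hβn]
  rw [← pow_mul]
  exact pow_le_pow_of_le_one hβ0.le hβ1.le (Nat.lt_mul_div_succ τ hn).le

lemma exists_isGeometricMixing (hP : P ∈ rowStochastic ℝ S) (hprim : P.IsPrimitive)
    (hμ : IsStationary P μ) : ∃ C β : ℝ, IsGeometricMixing P μ C β := by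
  obtain ⟨n, hn, δ, hδ0, hδ1, hδ⟩ := exists_minorization hprim hμ.1
  obtain ⟨β, hβ0, hβ1, hβ⟩ := exists_pow_div_le (sub_pos.2 hδ1) (sub_lt_self 1 hδ0) hn
  have hC : 1 < (1 - δ)⁻¹ := (one_lt_inv₀ (sub_pos.2 hδ1)).2 (sub_lt_self 1 hδ0)
  refine ⟨2 * (1 - δ)⁻¹, β, by linarith, hβ0, hβ1, fun τ s => ?_⟩
  calc l1Dist P μ τ s ≤ (1 - δ) ^ (τ / n) * 2 := by
        simpa only [Nat.mod_add_div] using l1Dist_add_mul_le hP hμ hδ1.le hδ (τ % n) (τ / n) s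
    _ ≤ 2 * (1 - δ)⁻¹ * β ^ τ := by linarith [hβ τ]

lemma IsGeometricMixing.exists_l1Dist_le {C β : ℝ} (h : IsGeometricMixing P μ C β) {ε : ℝ}
    (hε : 0 < ε) : ∃ τ, ∀ s, l1Dist P μ τ s ≤ ε := by
  obtain ⟨hC, -, hβ1, hdist⟩ := h
  obtain ⟨τ, hτ⟩ := exists_pow_lt_of_lt_one (div_pos hε (one_pos.trans hC)) hβ1
  exact ⟨τ, fun s => (hdist τ s).trans ((lt_div_iff₀' (one_pos.trans hC)).1 hτ).le⟩

lemma IsGeometricMixing.l1Dist_mixingTime_le {C β : ℝ} (h : IsGeometricMixing P μ C β) {ε : ℝ}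
    (hε : 0 < ε) (s : S) : l1Dist P μ (mixingTime P μ ε) s ≤ ε :=
  Nat.sInf_mem (s := {τ : ℕ | ∀ s, l1Dist P μ τ s ≤ ε}) (h.exists_l1Dist_le hε) s

end Mixing

section EdgeMean

variable {Z E : Type*} [Fintype Z] [NormedAddCommGroup E] {K : Matrix Z Z ℝ}

/-- The expectation of `f (z, z')` over an edge `(z, z')` of the Markov chain with transition
matrix `K`, where `z` has law `p`. -/
def edgeMean [NormedSpace ℝ E] (K : Matrix Z Z ℝ) (p : Z → ℝ) (f : Z → Z → E) : E :=
  ∑ z, p z • ∑ z', K z z' • f z z'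

lemma edgeMean_sub [NormedSpace ℝ E] (p : Z → ℝ) (f f' : Z → Z → E) :
    edgeMean K p (fun z z' => f z z' - f' z z') = edgeMean K p f - edgeMean K p f' := by
  simp only [edgeMean, smul_sub, Finset.sum_sub_distrib]

lemma edgeMean_const [NormedSpace ℝ E] [DecidableEq Z] (hK : K ∈ rowStochastic ℝ Z) {p : Z → ℝ}
    (hp : p ∈ stdSimplex ℝ Z) (c : E) : edgeMean K p (fun _ _ => c) = c := by
  simp only [edgeMean, ← Finset.sum_smul, sum_row_of_mem_rowStochastic hK, one_smul, hp.2]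

lemma norm_edgeMean_le [NormedSpace ℝ E] [DecidableEq Z] (hK : K ∈ rowStochastic ℝ Z)
    (p : Z → ℝ) {f : Z → Z → E} {c : ℝ} (hf : ∀ z z', ‖f z z'‖ ≤ c) :
    ‖edgeMean K p f‖ ≤ (∑ z, |p z|) * c := by
  rw [Finset.sum_mul]
  refine norm_sum_le_of_le _ fun z _ => ?_
  rw [norm_smul, Real.norm_eq_abs]
  refine mul_le_mul_of_nonneg_left ?_ (abs_nonneg _)
  calc ‖∑ z', K z z' • f z z'‖ ≤ ∑ z', K z z' * c := by
        refine norm_sum_le_of_le _ fun z' _ => ?_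
        rw [norm_smul, Real.norm_of_nonneg (nonneg_of_mem_rowStochastic hK)]
        exact mul_le_mul_of_nonneg_left (hf z z') (nonneg_of_mem_rowStochastic hK)
    _ = c := by rw [← Finset.sum_mul, sum_row_of_mem_rowStochastic hK, one_mul]

lemma norm_edgeMean_sub_le [NormedSpace ℝ E] [DecidableEq Z] (hK : K ∈ rowStochastic ℝ Z)
    (p q : Z → ℝ) {f : Z → Z → E} {c : ℝ} (hf : ∀ z z', ‖f z z'‖ ≤ c) :
    ‖edgeMean K p f - edgeMean K q f‖ ≤ (∑ z, |p z - q z|) * c := by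
  have hsub : edgeMean K p f - edgeMean K q f = edgeMean K (p - q) f := by
    simp only [edgeMean, ← Finset.sum_sub_distrib, ← sub_smul, Pi.sub_apply]
  rw [hsub]
  exact norm_edgeMean_le hK (p - q) hf

lemma edgeMean_inner [InnerProductSpace ℝ E] (p : Z → ℝ) (v : E) (f : Z → Z → E) :
    edgeMean K p (fun z z' => inner ℝ v (f z z')) = inner ℝ v (edgeMean K p f) := by
  simp only [edgeMean, inner_sum, real_inner_smul_right, smul_eq_mul]

end EdgeMean

section MarkovProperty

variable {Z Ω : Type*} [MeasurableSpace Z] [MeasurableSpace Ω] {Q : Measure Ω}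
  {K : Matrix Z Z ℝ} {W : ℕ → Ω → Z}

lemma measurable_domRestrict (hW : ∀ t, Measurable (W t)) (s : Set ℕ) :
    Measurable fun ω => s.domRestrict fun t => W t ω :=
  measurable_pi_lambda _ fun i => hW i

lemma IsMarkovChain.measureReal_path_succ (hW : IsMarkovChain Q K W) {k : ℕ}
    (p : Set.Iic k → Z) (b : Z) :
    Q.real {ω | ((Set.Iic k).domRestrict fun t => W t ω) = p ∧ W (k + 1) ω = b}
      = Q.real {ω | ((Set.Iic k).domRestrict fun t => W t ω) = p}
        * K (p ⟨k, Set.self_mem_Iic⟩) b := by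
  let x : ℕ → Z := fun i => if h : i ≤ k then p ⟨i, h⟩ else b
  have hx : ∀ i (h : i ≤ k), x i = p ⟨i, h⟩ := fun i h => dif_pos h
  have hxk : x (k + 1) = b := dif_neg (by omega)
  have hpast : ∀ ω, (∀ i ≤ k, W i ω = x i) ↔ (Set.Iic k).domRestrict (fun t => W t ω) = p :=
    fun ω => ⟨fun h => funext fun i => (h i i.2).trans (hx i i.2),
      fun h i hi => (congrFun h ⟨i, hi⟩).trans (hx i hi).symm⟩
  have hstep := hW.2 k x
  simp only [hpast, hx k le_rfl, hxk] at hstep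
  refine Eq.trans (congrArg Q.real ?_) hstep
  ext ω
  simp only [Set.mem_ofPred_eq, Nat.le_add_one_iff, or_imp, forall_and, forall_eq, hxk, hpast]

variable [MeasurableSingletonClass Z]

lemma measurableSet_path (k : ℕ) (x : ℕ → Z) : MeasurableSet {w : ℕ → Z | ∀ i ≤ k, w i = x i} := by
  simp only [Set.ofPred_forall]
  exact .iInter fun i => .iInter fun _ => measurable_pi_apply i (measurableSet_singleton _)

lemma integrable_of_dependsOn [Finite Z] [IsFiniteMeasure Q] (hW : ∀ t, Measurable (W t)) {k : ℕ}
    {f : (ℕ → Z) → ℝ} (hf : DependsOn f (Set.Iic k)) :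
    Integrable (fun ω => f fun t => W t ω) Q := by
  obtain ⟨g, rfl⟩ := dependsOn_iff_exists_comp.1 hf
  exact Integrable.of_finite.comp_measurable (measurable_domRestrict hW _)

lemma integral_comp_eq_sum [IsFiniteMeasure Q] {β : Type*} [Fintype β] [MeasurableSpace β]
    [MeasurableSingletonClass β] {Y : Ω → β} (hY : Measurable Y) (f : β → ℝ) :
    ∫ ω, f (Y ω) ∂Q = ∑ b, Q.real {ω | Y ω = b} * f b := by
  rw [← integral_map hY.aemeasurable Integrable.of_finite.aestronglyMeasurable,
    integral_fintype Integrable.of_finite]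
  simp only [map_measureReal_apply hY (measurableSet_singleton _), smul_eq_mul]
  rfl

variable [Fintype Z] [IsFiniteMeasure Q]

lemma IsMarkovChain.integral_succ (hW : IsMarkovChain Q K W) {k : ℕ}
    {f : (ℕ → Z) → Z → ℝ} (hf : DependsOn f (Set.Iic k)) :
    ∫ ω, f (fun t => W t ω) (W (k + 1) ω) ∂Q
      = ∫ ω, ∑ b, K (W k ω) b * f (fun t => W t ω) b ∂Q := by
  obtain ⟨g, rfl⟩ : ∃ g, f = g ∘ (Set.Iic k).domRestrict :=
    have : Nonempty (Z → ℝ) := ⟨0⟩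
    dependsOn_iff_exists_comp.1 hf
  have hpast := measurable_domRestrict hW.1 (Set.Iic k)
  calc _ = ∑ pb : (Set.Iic k → Z) × Z, _ * g pb.1 pb.2 :=
        integral_comp_eq_sum (hpast.prodMk (hW.1 (k + 1))) fun pb => g pb.1 pb.2
    _ = ∑ p, Q.real {ω | ((Set.Iic k).domRestrict fun t => W t ω) = p}
          * ∑ b, K (p ⟨k, Set.self_mem_Iic⟩) b * g p b := by
        simp only [Prod.mk.injEq, hW.measureReal_path_succ, Fintype.sum_prod_type,
          Finset.mul_sum, mul_assoc]
    _ = _ := (integral_comp_eq_sum hpast fun p => ∑ b, K (p ⟨k, Set.self_mem_Iic⟩) b * g p b).symm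

variable [DecidableEq Z]

lemma IsMarkovChain.integral_add (hW : IsMarkovChain Q K W) {k : ℕ} (τ : ℕ)
    {f : (ℕ → Z) → Z → ℝ} (hf : DependsOn f (Set.Iic k)) :
    ∫ ω, f (fun t => W t ω) (W (k + τ) ω) ∂Q
      = ∫ ω, ∑ a, (K ^ τ) (W k ω) a * f (fun t => W t ω) a ∂Q := by
  induction τ generalizing f with
  | zero => simp [Matrix.one_apply]
  | succ τ ih =>
    have hmono : DependsOn f (Set.Iic (k + τ)) := hf.mono (Set.Iic_subset_Iic.2 (by omega))
    have havg : DependsOn (fun w a => ∑ b, K a b * f w b) (Set.Iic k) := fun w w' h => by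
      simp only [hf h]
    rw [← add_assoc, hW.integral_succ hmono, ih havg]
    simp only [pow_succ, Matrix.mul_apply, Finset.mul_sum, Finset.sum_mul, mul_assoc]
    congr 1 with ω
    exact Finset.sum_comm

lemma IsMarkovChain.integral_edge (hW : IsMarkovChain Q K W) {k : ℕ} (τ : ℕ)
    {f : (ℕ → Z) → Z → Z → ℝ} (hf : DependsOn f (Set.Iic k)) :
    ∫ ω, f (fun t => W t ω) (W (k + τ) ω) (W (k + τ + 1) ω) ∂Q
      = ∫ ω, edgeMean K ((K ^ τ) (W k ω)) (f fun t => W t ω) ∂Q := by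
  have hnow : DependsOn (fun w => f w (w (k + τ))) (Set.Iic (k + τ)) := fun w w' h => by
    simp only [hf fun i hi => h i (Set.mem_Iic.2 (le_add_right hi)),
      h (k + τ) Set.self_mem_Iic]
  have havg : DependsOn (fun w a => ∑ b, K a b * f w a b) (Set.Iic k) := fun w w' h => by
    simp only [hf h]
  rw [hW.integral_succ hnow, hW.integral_add τ havg]
  rfl

end MarkovProperty

section ProductChain

variable {S S' : Type*}

open scoped Kronecker

lemma IsMarkovChain.prodMk {Ω : Type*} [MeasurableSpace Ω] [MeasurableSpace S]
    [MeasurableSingletonClass S] [MeasurableSpace S'] [MeasurableSingletonClass S']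
    {Q : Measure Ω} {P : Matrix S S ℝ} {P' : Matrix S' S' ℝ} {X : ℕ → Ω → S} {Y : ℕ → Ω → S'}
    (hX : IsMarkovChain Q P X) (hY : IsMarkovChain Q P' Y)
    (hXY : IndepFun (fun ω t => X t ω) (fun ω t => Y t ω) Q) :
    IsMarkovChain Q (P ⊗ₖ P') fun t ω => (X t ω, Y t ω) := by
  refine ⟨fun t => (hX.1 t).prodMk (hY.1 t), fun t z => ?_⟩
  have hpath : ∀ n, Q.real {ω | ∀ i ≤ n, (X i ω, Y i ω) = z i}
      = Q.real {ω | ∀ i ≤ n, X i ω = (z i).1} * Q.real {ω | ∀ i ≤ n, Y i ω = (z i).2} := by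
    intro n
    have hind := congrArg ENNReal.toReal
      (hXY.measure_inter_preimage_eq_mul _ _ (measurableSet_path n fun i => (z i).1)
        (measurableSet_path n fun i => (z i).2))
    rw [ENNReal.toReal_mul] at hind
    refine Eq.trans (congrArg Q.real ?_) hind
    ext ω
    simp only [Prod.ext_iff, Set.mem_ofPred_eq, Set.mem_inter_iff, Set.mem_preimage, forall_and]
  rw [hpath, hpath, hX.2, hY.2, kroneckerMap_apply]
  ring

variable [Fintype S] [Fintype S']

lemma mul_mem_stdSimplex {p : S → ℝ} {p' : S' → ℝ} (hp : p ∈ stdSimplex ℝ S)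
    (hp' : p' ∈ stdSimplex ℝ S') : (fun z : S × S' => p z.1 * p' z.2) ∈ stdSimplex ℝ (S × S') := by
  refine ⟨fun z => mul_nonneg (hp.1 _) (hp'.1 _), ?_⟩
  rw [Fintype.sum_prod_type, ← Finset.sum_mul_sum, hp.2, hp'.2, one_mul]

variable [DecidableEq S] [DecidableEq S']

lemma kronecker_pow (P : Matrix S S ℝ) (P' : Matrix S' S' ℝ) (n : ℕ) :
    (P ⊗ₖ P') ^ n = (P ^ n) ⊗ₖ (P' ^ n) := by
  induction n with
  | zero => simp only [pow_zero, one_kronecker_one]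
  | succ n ih => rw [pow_succ, ih, ← mul_kronecker_mul, ← pow_succ, ← pow_succ]

lemma kronecker_mem_rowStochastic {P : Matrix S S ℝ} {P' : Matrix S' S' ℝ}
    (hP : P ∈ rowStochastic ℝ S) (hP' : P' ∈ rowStochastic ℝ S') :
    P ⊗ₖ P' ∈ rowStochastic ℝ (S × S') := by
  refine mem_rowStochastic_iff_sum.2 ⟨fun z z' => mul_nonneg (nonneg_of_mem_rowStochastic hP)
    (nonneg_of_mem_rowStochastic hP'), fun z => ?_⟩
  simp only [kroneckerMap_apply]
  rw [Fintype.sum_prod_type, ← Finset.sum_mul_sum, sum_row_of_mem_rowStochastic hP,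
    sum_row_of_mem_rowStochastic hP', one_mul]

lemma l1Dist_kronecker_le {P : Matrix S S ℝ} {P' : Matrix S' S' ℝ} {μ : S → ℝ} {μ' : S' → ℝ}
    (hP' : P' ∈ rowStochastic ℝ S') (hμ : μ ∈ stdSimplex ℝ S) (τ : ℕ) (z : S × S') :
    l1Dist (P ⊗ₖ P') (fun z => μ z.1 * μ' z.2) τ z ≤ l1Dist P μ τ z.1 + l1Dist P' μ' τ z.2 := by
  have hP'τ : ∀ a', 0 ≤ (P' ^ τ) z.2 a' := fun _ => nonneg_of_mem_rowStochastic (pow_mem hP' τ)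
  have hsplit : ∀ a a', |(P ^ τ) z.1 a * (P' ^ τ) z.2 a' - μ a * μ' a'|
      ≤ |(P ^ τ) z.1 a - μ a| * (P' ^ τ) z.2 a' + μ a * |(P' ^ τ) z.2 a' - μ' a'| := by
    intro a a'
    calc _ = |((P ^ τ) z.1 a - μ a) * (P' ^ τ) z.2 a' + μ a * ((P' ^ τ) z.2 a' - μ' a')| := by
          ring_nf
      _ ≤ _ := (abs_add_le _ _).trans_eq (by
          rw [abs_mul, abs_mul, abs_of_nonneg (hP'τ a'), abs_of_nonneg (hμ.1 a)])
  calc l1Dist (P ⊗ₖ P') (fun z => μ z.1 * μ' z.2) τ z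
      ≤ ∑ a, ∑ a', (|(P ^ τ) z.1 a - μ a| * (P' ^ τ) z.2 a'
          + μ a * |(P' ^ τ) z.2 a' - μ' a'|) := by
        simp only [l1Dist, kronecker_pow, Fintype.sum_prod_type, kroneckerMap_apply]
        exact Finset.sum_le_sum fun a _ => Finset.sum_le_sum fun a' _ => hsplit a a'
    _ = l1Dist P μ τ z.1 + l1Dist P' μ' τ z.2 := by
        simp only [Finset.sum_add_distrib, ← Finset.mul_sum, ← Finset.sum_mul, sum_pow_row hP',
          hμ.2, mul_one, one_mul, l1Dist]

end ProductChain

section AffineRecursion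

variable {e : ℕ → ℝ} {b D ρ : ℝ}

lemma forall_le_of_forall_le_imp_succ_le {τ : ℕ} (hinit : ∀ t ≤ τ, e t ≤ b) (hρ : ρ ≤ 1)
    (hD : D ≤ ρ * b)
    (hstep : ∀ n, (∀ t ≤ n + τ, e t ≤ b) → e (n + τ + 1) ≤ (1 - ρ) * e (n + τ) + D) (t : ℕ) :
    e t ≤ b := by
  induction t using Nat.strong_induction_on with
  | _ t ih =>
    rcases le_or_gt t τ with ht | ht
    · exact hinit t ht
    obtain ⟨n, rfl⟩ := Nat.exists_eq_add_of_lt ht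
    rw [add_comm τ n] at ih ⊢
    have hprev := mul_le_mul_of_nonneg_left (ih (n + τ) (Nat.lt_succ_self _)) (sub_nonneg.2 hρ)
    linarith [hstep n fun t ht => ih t (Nat.lt_succ_of_le ht)]

lemma le_exp_mul_add_div_of_succ_le (hρ0 : 0 < ρ) (hρ1 : ρ ≤ 1) (hb : 0 ≤ b) (hD : 0 ≤ D)
    (hinit : e 0 ≤ b) (hstep : ∀ n, e (n + 1) ≤ (1 - ρ) * e n + D) (n : ℕ) :
    e n ≤ Real.exp (-(ρ * n)) * b + D / ρ := by
  induction n with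
  | zero => simpa using hinit.trans (le_add_of_nonneg_right (div_nonneg hD hρ0.le))
  | succ n ih =>
    calc e (n + 1) ≤ (1 - ρ) * (Real.exp (-(ρ * n)) * b + D / ρ) + D :=
          (hstep n).trans (by gcongr)
      _ = (1 - ρ) * (Real.exp (-(ρ * n)) * b) + D / ρ := by field_simp; ring
      _ ≤ Real.exp (-ρ) * (Real.exp (-(ρ * n)) * b) + D / ρ := by
          gcongr; exact Real.one_sub_le_exp_neg ρ
      _ = Real.exp (-(ρ * (n + 1 : ℕ))) * b + D / ρ := by
          rw [← mul_assoc, ← Real.exp_add]; push_cast; ring_nf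

end AffineRecursion

section LipschitzUpdate

variable {Z E : Type*} [NormedAddCommGroup E]

/-- The update direction is `M`-Lipschitz in the parameter and is bounded by `M c` at `θstar`. The
bound is scaled by `M` so that `M * (‖θ - θstar‖ + c)` dominates the update at `θ`. -/
structure IsLipschitzUpdate (g : Z → Z → E → E) (M c : ℝ) (θstar : E) : Prop where
  lipschitz_nonneg : 0 ≤ M
  bound_nonneg : 0 ≤ c
  lipschitz : ∀ z z' θ θ', ‖g z z' θ - g z z' θ'‖ ≤ M * ‖θ - θ'‖
  norm_apply_star_le : ∀ z z', ‖g z z' θstar‖ ≤ M * c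

lemma IsLipschitzUpdate.norm_apply_le {g : Z → Z → E → E} {M c : ℝ} {θstar : E}
    (hg : IsLipschitzUpdate g M c θstar) (z z' : Z) (θ : E) :
    ‖g z z' θ‖ ≤ M * (‖θ - θstar‖ + c) := by
  calc ‖g z z' θ‖ ≤ ‖g z z' θ - g z z' θstar‖ + ‖g z z' θstar‖ := norm_le_norm_sub_add _ _
    _ ≤ M * ‖θ - θstar‖ + M * c :=
        add_le_add (hg.lipschitz z z' θ θstar) (hg.norm_apply_star_le z z')
    _ = M * (‖θ - θstar‖ + c) := (mul_add _ _ _).symm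

variable [NormedSpace ℝ E]

/-- The iterates of stochastic approximation with constant stepsize `α`, started at `θ₀` and driven
by the successive edges of the trajectory `w`. -/
def markovSA (g : Z → Z → E → E) (α : ℝ) (θ₀ : E) (w : ℕ → Z) : ℕ → E
  | 0 => θ₀
  | t + 1 => markovSA g α θ₀ w t + α • g (w t) (w (t + 1)) (markovSA g α θ₀ w t)

lemma dependsOn_markovSA (g : Z → Z → E → E) (α : ℝ) (θ₀ : E) (t : ℕ) :
    DependsOn (fun w => markovSA g α θ₀ w t) (Set.Iic t) := by
  induction t with
  | zero => exact fun _ _ _ => rfl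
  | succ t ih =>
    intro w w' h
    have ht : markovSA g α θ₀ w t = markovSA g α θ₀ w' t :=
      ih fun i hi => h i (Set.mem_Iic.2 (Nat.le_succ_of_le hi))
    simp only [markovSA, ht, h t (Set.mem_Iic.2 t.le_succ), h (t + 1) Set.self_mem_Iic]

namespace IsLipschitzUpdate

variable {g : Z → Z → E → E} {M c α : ℝ} {θstar : E}

lemma norm_markovSA_succ_sub_le (hg : IsLipschitzUpdate g M c θstar) (hα : 0 ≤ α) (θ₀ : E)
    (w : ℕ → Z) (t : ℕ) :
    ‖markovSA g α θ₀ w (t + 1) - markovSA g α θ₀ w t‖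
      ≤ α * M * (‖markovSA g α θ₀ w t - θstar‖ + c) := by
  rw [markovSA, add_sub_cancel_left, norm_smul, Real.norm_of_nonneg hα, mul_assoc]
  exact mul_le_mul_of_nonneg_left (hg.norm_apply_le _ _ _) hα

lemma norm_markovSA_add_sub_le (hg : IsLipschitzUpdate g M c θstar) (hα : 0 ≤ α) (θ₀ : E)
    (w : ℕ → Z) (k n : ℕ) :
    ‖markovSA g α θ₀ w (k + n) - markovSA g α θ₀ w k‖
      ≤ ∑ j ∈ Finset.range n, α * M * (‖markovSA g α θ₀ w (k + j) - θstar‖ + c) := by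
  rw [← add_zero k, add_assoc, zero_add,
    ← Finset.sum_range_sub (fun j => markovSA g α θ₀ w (k + j)) n]
  exact norm_sum_le_of_le _ fun j _ => hg.norm_markovSA_succ_sub_le hα θ₀ w (k + j)

lemma norm_markovSA_sub_add_le (hg : IsLipschitzUpdate g M c θstar) (hα : 0 ≤ α) (θ₀ : E)
    (w : ℕ → Z) (t : ℕ) :
    ‖markovSA g α θ₀ w t - θstar‖ + c ≤ Real.exp (α * M * t) * (‖θ₀ - θstar‖ + c) := by
  induction t with
  | zero => simp [markovSA]
  | succ t ih =>
    have hstep := norm_sub_le_norm_sub_add_norm_sub (markovSA g α θ₀ w (t + 1))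
      (markovSA g α θ₀ w t) θstar
    calc ‖markovSA g α θ₀ w (t + 1) - θstar‖ + c
        ≤ (α * M + 1) * (‖markovSA g α θ₀ w t - θstar‖ + c) := by
          linarith [hg.norm_markovSA_succ_sub_le hα θ₀ w t]
      _ ≤ Real.exp (α * M) * (Real.exp (α * M * t) * (‖θ₀ - θstar‖ + c)) :=
          mul_le_mul (Real.add_one_le_exp _) ih (add_nonneg (norm_nonneg _) hg.bound_nonneg)
            (Real.exp_pos _).le
      _ = Real.exp (α * M * (t + 1 : ℕ)) * (‖θ₀ - θstar‖ + c) := by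
          rw [← mul_assoc, ← Real.exp_add, Nat.cast_succ, mul_add_one, add_comm]

lemma norm_markovSA_sub_le (hg : IsLipschitzUpdate g M c θstar) (hα : 0 ≤ α) (θ₀ : E)
    (w : ℕ → Z) {τ t : ℕ} (hτ : α * M * τ ≤ Real.log 2) (ht : t ≤ τ) :
    ‖markovSA g α θ₀ w t - θstar‖ ≤ 2 * ‖θ₀ - θstar‖ + c := by
  have hM := hg.lipschitz_nonneg
  have hexp : Real.exp (α * M * t) ≤ 2 := by
    rw [← Real.exp_log two_pos]
    exact Real.exp_le_exp.2 ((mul_le_mul_of_nonneg_left (Nat.cast_le.2 ht)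
      (mul_nonneg hα hM)).trans hτ)
  have hgrow := (hg.norm_markovSA_sub_add_le hα θ₀ w t).trans
    (mul_le_mul_of_nonneg_right hexp (add_nonneg (norm_nonneg (θ₀ - θstar)) hg.bound_nonneg))
  linarith

end IsLipschitzUpdate

variable [MeasurableSpace Z] {Ω : Type*} [MeasurableSpace Ω]

/-- The mean square distance to `θstar` after `t` iterations of stochastic approximation driven by
the random trajectory `W`. -/
def meanSqDist (Q : Measure Ω) (g : Z → Z → E → E) (α : ℝ) (θ₀ θstar : E) (W : ℕ → Ω → Z)
    (t : ℕ) : ℝ :=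
  ∫ ω, ‖markovSA g α θ₀ (fun t => W t ω) t - θstar‖ ^ 2 ∂Q

lemma integrable_norm_markovSA_sub_sq [Finite Z] [MeasurableSingletonClass Z] {Q : Measure Ω}
    [IsFiniteMeasure Q] {W : ℕ → Ω → Z} (hW : ∀ t, Measurable (W t))
    (g : Z → Z → E → E) (α : ℝ) (θ₀ θstar : E) (t : ℕ) :
    Integrable (fun ω => ‖markovSA g α θ₀ (fun t => W t ω) t - θstar‖ ^ 2) Q :=
  integrable_of_dependsOn hW (f := fun w => ‖markovSA g α θ₀ w t - θstar‖ ^ 2) fun _ _ h =>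
    congrArg (‖· - θstar‖ ^ 2) (dependsOn_markovSA g α θ₀ t h)

lemma IsLipschitzUpdate.meanSqDist_le_sq [Finite Z] [MeasurableSingletonClass Z] {Q : Measure Ω}
    [IsProbabilityMeasure Q] {W : ℕ → Ω → Z} {g : Z → Z → E → E} {M c α : ℝ} {θstar : E}
    (hg : IsLipschitzUpdate g M c θstar) (hW : ∀ t, Measurable (W t)) (hα : 0 ≤ α)
    (θ₀ : E) {τ t : ℕ} (hτ : α * M * τ ≤ Real.log 2) (ht : t ≤ τ) :
    meanSqDist Q g α θ₀ θstar W t ≤ (2 * ‖θ₀ - θstar‖ + c) ^ 2 := by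
  calc meanSqDist Q g α θ₀ θstar W t ≤ ∫ _, (2 * ‖θ₀ - θstar‖ + c) ^ 2 ∂Q :=
        integral_mono (integrable_norm_markovSA_sub_sq hW g α θ₀ θstar t) (integrable_const _)
          fun ω => pow_le_pow_left₀ (norm_nonneg _)
            (hg.norm_markovSA_sub_le hα θ₀ (fun t => W t ω) hτ ht) 2
    _ = (2 * ‖θ₀ - θstar‖ + c) ^ 2 := by rw [integral_const, probReal_univ, one_smul]

end LipschitzUpdate

section DissipativeUpdate

variable {Z E : Type*} [NormedAddCommGroup E] [InnerProductSpace ℝ E] [Fintype Z]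

/-- The scalar noise `⟨θ - θstar, g(z, z', θ) - ḡ(θ)⟩`, where `ḡ` is the stationary mean of `g`. -/
def noise (K : Matrix Z Z ℝ) (ν : Z → ℝ) (g : Z → Z → E → E) (θstar θ : E) (z z' : Z) : ℝ :=
  inner ℝ (θ - θstar) (g z z' θ - edgeMean K ν fun z z' => g z z' θ)

/-- The `M`-Lipschitz update direction `g` has a mean field, its expectation over the stationary
edges of the chain with transition matrix `K` and law `ν`, which vanishes at `θstar` and points
towards `θstar` with strength `η`. -/
structure IsDissipativeUpdate (K : Matrix Z Z ℝ) (ν : Z → ℝ) (g : Z → Z → E → E) (M c η : ℝ)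
    (θstar : E) : Prop extends IsLipschitzUpdate g M c θstar where
  mean_star_eq_zero : edgeMean K ν (fun z z' => g z z' θstar) = 0
  inner_mean_le : ∀ θ, inner ℝ (θ - θstar) (edgeMean K ν fun z z' => g z z' θ)
    ≤ -(η * ‖θ - θstar‖ ^ 2)

section OneStep

variable {K : Matrix Z Z ℝ} {ν : Z → ℝ} {g : Z → Z → E → E} {M c η α : ℝ} {θstar : E}

lemma IsDissipativeUpdate.norm_add_smul_sub_sq_le (hg : IsDissipativeUpdate K ν g M c η θstar)
    (hα : 0 ≤ α) (θ : E) (z z' : Z) :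
    ‖θ + α • g z z' θ - θstar‖ ^ 2
      ≤ (1 - 2 * α * η) * ‖θ - θstar‖ ^ 2 + 2 * α * noise K ν g θstar θ z z'
        + α ^ 2 * M ^ 2 * (2 * ‖θ - θstar‖ ^ 2 + 2 * c ^ 2) := by
  have hsq : ‖g z z' θ‖ ^ 2 ≤ M ^ 2 * (2 * ‖θ - θstar‖ ^ 2 + 2 * c ^ 2) := by
    calc ‖g z z' θ‖ ^ 2 ≤ (M * (‖θ - θstar‖ + c)) ^ 2 :=
          pow_le_pow_left₀ (norm_nonneg _) (hg.norm_apply_le z z' θ) 2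
      _ ≤ M ^ 2 * (2 * ‖θ - θstar‖ ^ 2 + 2 * c ^ 2) := by
          rw [mul_pow, ← mul_add]
          exact mul_le_mul_of_nonneg_left add_sq_le (sq_nonneg M)
  have hexpand : ‖θ + α • g z z' θ - θstar‖ ^ 2 = ‖θ - θstar‖ ^ 2
      + 2 * α * inner ℝ (θ - θstar) (g z z' θ) + α ^ 2 * ‖g z z' θ‖ ^ 2 := by
    rw [add_sub_right_comm, norm_add_sq_real, real_inner_smul_right, norm_smul, mul_pow,
      Real.norm_eq_abs, sq_abs, mul_assoc]
  have hinner : inner ℝ (θ - θstar) (g z z' θ)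
      ≤ noise K ν g θstar θ z z' - η * ‖θ - θstar‖ ^ 2 := by
    rw [noise, inner_sub_right]
    linarith [hg.inner_mean_le θ]
  rw [hexpand]
  linarith [mul_le_mul_of_nonneg_left hinner (mul_nonneg two_pos.le hα),
    mul_le_mul_of_nonneg_left hsq (sq_nonneg α)]

variable [DecidableEq Z]

lemma IsLipschitzUpdate.norm_mean_sub_le (hg : IsLipschitzUpdate g M c θstar)
    (hK : K ∈ rowStochastic ℝ Z) (hν : ν ∈ stdSimplex ℝ Z) (θ θ' : E) :
    ‖edgeMean K ν (fun z z' => g z z' θ) - edgeMean K ν fun z z' => g z z' θ'‖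
      ≤ M * ‖θ - θ'‖ := by
  rw [← edgeMean_sub]
  refine (norm_edgeMean_le hK ν fun z z' => hg.lipschitz z z' θ θ').trans_eq ?_
  simp only [abs_of_nonneg (hν.1 _), hν.2, one_mul]

lemma IsLipschitzUpdate.edgeMean_noise_le (hg : IsLipschitzUpdate g M c θstar)
    (hK : K ∈ rowStochastic ℝ Z) {p : Z → ℝ} (hp : p ∈ stdSimplex ℝ Z) {δ : ℝ}
    (hδ : ∑ z, |p z - ν z| ≤ δ) (θ : E) :
    2 * edgeMean K p (noise K ν g θstar θ) ≤ δ * M * (3 * ‖θ - θstar‖ ^ 2 + c ^ 2) := by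
  have hM := hg.lipschitz_nonneg
  have hc := hg.bound_nonneg
  have hmean : edgeMean K p (noise K ν g θstar θ) = inner ℝ (θ - θstar)
      ((edgeMean K p fun z z' => g z z' θ) - edgeMean K ν fun z z' => g z z' θ) := by
    unfold noise
    rw [edgeMean_inner, edgeMean_sub, edgeMean_const hK hp]
  have hclose : ‖(edgeMean K p fun z z' => g z z' θ) - edgeMean K ν fun z z' => g z z' θ‖
      ≤ δ * (M * (‖θ - θstar‖ + c)) :=
    (norm_edgeMean_sub_le hK p ν fun z z' => hg.norm_apply_le z z' θ).trans
      (mul_le_mul_of_nonneg_right hδ (by positivity))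
  have hδM : 0 ≤ δ * M := mul_nonneg ((Finset.sum_nonneg fun _ _ => abs_nonneg _).trans hδ) hM
  calc 2 * edgeMean K p (noise K ν g θstar θ)
      ≤ 2 * (‖θ - θstar‖ * (δ * (M * (‖θ - θstar‖ + c)))) := by
        rw [hmean]
        exact mul_le_mul_of_nonneg_left ((real_inner_le_norm _ _).trans
          (mul_le_mul_of_nonneg_left hclose (norm_nonneg _))) two_pos.le
    _ = δ * M * (2 * ‖θ - θstar‖ ^ 2 + 2 * ‖θ - θstar‖ * c) := by ring
    _ ≤ δ * M * (3 * ‖θ - θstar‖ ^ 2 + c ^ 2) := by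
        refine mul_le_mul_of_nonneg_left ?_ hδM
        linarith [two_mul_le_add_sq ‖θ - θstar‖ c]

-- Test the dissipativity at `θstar + v` against the Lipschitz bound.
lemma IsDissipativeUpdate.rate_le_lipschitz [Nontrivial E]
    (hg : IsDissipativeUpdate K ν g M c η θstar) (hK : K ∈ rowStochastic ℝ Z)
    (hν : ν ∈ stdSimplex ℝ Z) : η ≤ M := by
  obtain ⟨v, hv⟩ := exists_ne (0 : E)
  have hdiss := hg.inner_mean_le (θstar + v)
  have hlip := hg.norm_mean_sub_le hK hν (θstar + v) θstar
  rw [hg.mean_star_eq_zero, sub_zero] at hlip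
  rw [add_sub_cancel_left] at hdiss hlip
  have hinner := (abs_le.1 (abs_real_inner_le_norm v
    (edgeMean K ν fun z z' => g z z' (θstar + v)))).1
  refine le_of_mul_le_mul_right (a := ‖v‖ ^ 2) ?_ (by positivity)
  nlinarith [mul_le_mul_of_nonneg_left hlip (norm_nonneg v)]

lemma IsDissipativeUpdate.noise_sub_noise_le (hg : IsDissipativeUpdate K ν g M c η θstar)
    (hK : K ∈ rowStochastic ℝ Z) (hν : ν ∈ stdSimplex ℝ Z) (θ θ' : E) (z z' : Z) :
    noise K ν g θstar θ z z' - noise K ν g θstar θ' z z'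
      ≤ ‖θ - θ'‖ * (M * (2 * ‖θ - θstar‖ + 2 * ‖θ' - θstar‖ + c)) := by
  set h : E → E := fun θ => g z z' θ - edgeMean K ν fun z z' => g z z' θ
  have hlip : ∀ θ θ', ‖h θ - h θ'‖ ≤ 2 * M * ‖θ - θ'‖ := fun θ θ' => by
    rw [sub_sub_sub_comm]
    linarith [norm_sub_le (g z z' θ - g z z' θ') ((edgeMean K ν fun z z' => g z z' θ)
      - edgeMean K ν fun z z' => g z z' θ'), hg.lipschitz z z' θ θ',
      hg.norm_mean_sub_le hK hν θ θ']
  have hstar : ‖h θstar‖ ≤ M * c := by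
    simpa only [h, hg.mean_star_eq_zero, sub_zero] using hg.norm_apply_star_le z z'
  have hbound : ‖h θ'‖ ≤ 2 * M * ‖θ' - θstar‖ + M * c :=
    (norm_le_norm_sub_add _ (h θstar)).trans (add_le_add (hlip _ _) hstar)
  calc noise K ν g θstar θ z z' - noise K ν g θstar θ' z z'
      = inner ℝ (θ - θstar) (h θ - h θ') + inner ℝ (θ - θ') (h θ') := by
        simp only [noise, h, inner_sub_left, inner_sub_right]; ring
    _ ≤ ‖θ - θstar‖ * (2 * M * ‖θ - θ'‖) + ‖θ - θ'‖ * (2 * M * ‖θ' - θstar‖ + M * c) :=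
        add_le_add ((real_inner_le_norm _ _).trans (by gcongr; exact hlip _ _))
          ((real_inner_le_norm _ _).trans (by gcongr))
    _ = _ := by ring

section Drift

variable (hg : IsDissipativeUpdate K ν g M c η θstar) (hK : K ∈ rowStochastic ℝ Z)
  (hν : ν ∈ stdSimplex ℝ Z)

include hg hK hν

lemma IsDissipativeUpdate.noise_markovSA_sub_le (hα : 0 ≤ α) (θ₀ : E) (w : ℕ → Z) (k τ : ℕ)
    (z z' : Z) :
    noise K ν g θstar (markovSA g α θ₀ w (k + τ)) z z'
        - noise K ν g θstar (markovSA g α θ₀ w k) z z'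
      ≤ α * M ^ 2 / 2 * ∑ j ∈ Finset.range τ, (5 * ‖markovSA g α θ₀ w (k + j) - θstar‖ ^ 2
        + 4 * ‖markovSA g α θ₀ w (k + τ) - θstar‖ ^ 2
        + 4 * ‖markovSA g α θ₀ w k - θstar‖ ^ 2 + 7 * c ^ 2) := by
  have hM := hg.lipschitz_nonneg
  have hc := hg.bound_nonneg
  set v := ‖markovSA g α θ₀ w (k + τ) - θstar‖
  set u := ‖markovSA g α θ₀ w k - θstar‖
  calc noise K ν g θstar (markovSA g α θ₀ w (k + τ)) z z'
        - noise K ν g θstar (markovSA g α θ₀ w k) z z'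
      ≤ (∑ j ∈ Finset.range τ, α * M * (‖markovSA g α θ₀ w (k + j) - θstar‖ + c))
          * (M * (2 * v + 2 * u + c)) :=
        (hg.noise_sub_noise_le hK hν _ _ z z').trans (mul_le_mul_of_nonneg_right
          (hg.norm_markovSA_add_sub_le hα θ₀ w k τ) (by positivity))
    _ = α * M ^ 2 / 2 * ∑ j ∈ Finset.range τ,
          2 * (‖markovSA g α θ₀ w (k + j) - θstar‖ + c) * (2 * v + 2 * u + c) := by
        rw [Finset.sum_mul, Finset.mul_sum]
        exact Finset.sum_congr rfl fun j _ => by ring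
    _ ≤ _ := by
        refine mul_le_mul_of_nonneg_left (Finset.sum_le_sum fun j _ => ?_) (by positivity)
        set x := ‖markovSA g α θ₀ w (k + j) - θstar‖
        linarith [two_mul_le_add_sq x v, two_mul_le_add_sq x u, two_mul_le_add_sq x c,
          two_mul_le_add_sq c v, two_mul_le_add_sq c u]

lemma IsDissipativeUpdate.norm_markovSA_sub_sq_le (hα : 0 ≤ α) (θ₀ : E) (w : ℕ → Z) (k τ : ℕ) :
    ‖markovSA g α θ₀ w (k + τ + 1) - θstar‖ ^ 2
      ≤ (1 - 2 * α * η) * ‖markovSA g α θ₀ w (k + τ) - θstar‖ ^ 2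
        + 2 * α * noise K ν g θstar (markovSA g α θ₀ w k) (w (k + τ)) (w (k + τ + 1))
        + α ^ 2 * M ^ 2 * ((∑ j ∈ Finset.range τ, (5 * ‖markovSA g α θ₀ w (k + j) - θstar‖ ^ 2
            + 4 * ‖markovSA g α θ₀ w (k + τ) - θstar‖ ^ 2
            + 4 * ‖markovSA g α θ₀ w k - θstar‖ ^ 2 + 7 * c ^ 2))
          + 2 * ‖markovSA g α θ₀ w (k + τ) - θstar‖ ^ 2 + 2 * c ^ 2) := by
  have hstep := hg.norm_add_smul_sub_sq_le hα (markovSA g α θ₀ w (k + τ)) (w (k + τ))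
    (w (k + τ + 1))
  have hdelay := mul_le_mul_of_nonneg_left (hg.noise_markovSA_sub_le hK hν hα θ₀ w k τ
    (w (k + τ)) (w (k + τ + 1))) (mul_nonneg two_pos.le hα)
  rw [markovSA]
  linarith

end Drift

end OneStep

section MeanSquare

variable {Ω : Type*} [MeasurableSpace Ω] [MeasurableSpace Z] [MeasurableSingletonClass Z]
  [DecidableEq Z] {Q : Measure Ω} [IsProbabilityMeasure Q] {K : Matrix Z Z ℝ} {ν : Z → ℝ}
  {g : Z → Z → E → E} {M c η α : ℝ} {θstar : E} {W : ℕ → Ω → Z}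

lemma IsLipschitzUpdate.integral_noise_le (hg : IsLipschitzUpdate g M c θstar)
    (hK : K ∈ rowStochastic ℝ Z) (hW : IsMarkovChain Q K W) (θ₀ : E) {τ : ℕ} {δ : ℝ}
    (hδ : ∀ z, l1Dist K ν τ z ≤ δ) (k : ℕ) :
    2 * ∫ ω, noise K ν g θstar (markovSA g α θ₀ (fun t => W t ω) k) (W (k + τ) ω)
        (W (k + τ + 1) ω) ∂Q
      ≤ δ * M * (3 * meanSqDist Q g α θ₀ θstar W k + c ^ 2) := by
  have hdep : DependsOn (fun w => noise K ν g θstar (markovSA g α θ₀ w k)) (Set.Iic k) :=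
    fun _ _ h => congrArg (noise K ν g θstar) (dependsOn_markovSA g α θ₀ k h)
  have hsq := integrable_norm_markovSA_sub_sq (Q := Q) hW.1 g α θ₀ θstar k
  rw [hW.integral_edge τ hdep, ← integral_const_mul]
  calc _ ≤ ∫ ω, δ * M * (3 * ‖markovSA g α θ₀ (fun t => W t ω) k - θstar‖ ^ 2 + c ^ 2) ∂Q := by
        refine integral_mono ?_ (((hsq.const_mul 3).add (integrable_const _)).const_mul _)
          fun ω => hg.edgeMean_noise_le hK ?_ (hδ _) _
        · refine (integrable_of_dependsOn (k := k) hW.1 (f := fun w =>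
            2 * edgeMean K ((K ^ τ) (w k)) (noise K ν g θstar (markovSA g α θ₀ w k)))
            fun w w' h => ?_)
          simp only [hdep h, h k Set.self_mem_Iic]
        · exact ⟨fun _ => nonneg_of_mem_rowStochastic (pow_mem hK τ), sum_pow_row hK τ _⟩
    _ = δ * M * (3 * meanSqDist Q g α θ₀ θstar W k + c ^ 2) := by
        rw [integral_const_mul, integral_add (hsq.const_mul 3) (integrable_const _),
          integral_const_mul, integral_const, probReal_univ, one_smul, meanSqDist]

lemma IsDissipativeUpdate.meanSqDist_succ_le (hg : IsDissipativeUpdate K ν g M c η θstar)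
    (hK : K ∈ rowStochastic ℝ Z) (hν : ν ∈ stdSimplex ℝ Z) (hW : IsMarkovChain Q K W)
    (hα : 0 ≤ α) (θ₀ : E) {τ : ℕ} {δ : ℝ} (hδ : ∀ z, l1Dist K ν τ z ≤ δ) (k : ℕ) :
    meanSqDist Q g α θ₀ θstar W (k + τ + 1)
      ≤ (1 - 2 * α * η) * meanSqDist Q g α θ₀ θstar W (k + τ)
        + α * (δ * M * (3 * meanSqDist Q g α θ₀ θstar W k + c ^ 2))
        + α ^ 2 * M ^ 2 * ((∑ j ∈ Finset.range τ, (5 * meanSqDist Q g α θ₀ θstar W (k + j)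
            + 4 * meanSqDist Q g α θ₀ θstar W (k + τ)
            + 4 * meanSqDist Q g α θ₀ θstar W k + 7 * c ^ 2))
          + 2 * meanSqDist Q g α θ₀ θstar W (k + τ) + 2 * c ^ 2) := by
  have hsq := integrable_norm_markovSA_sub_sq (Q := Q) hW.1 g α θ₀ θstar
  have hnoise : Integrable (fun ω => noise K ν g θstar (markovSA g α θ₀ (fun t => W t ω) k)
      (W (k + τ) ω) (W (k + τ + 1) ω)) Q :=
    integrable_of_dependsOn (k := k + τ + 1) hW.1 (f := fun w =>
      noise K ν g θstar (markovSA g α θ₀ w k) (w (k + τ)) (w (k + τ + 1))) fun w w' h => by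
        simp only [dependsOn_markovSA g α θ₀ k fun i hi => h i (Set.mem_Iic.2 (by
          have := Set.mem_Iic.1 hi; omega)), h (k + τ) (Set.mem_Iic.2 (by omega)),
          h (k + τ + 1) Set.self_mem_Iic]
  have hnoise_le := mul_le_mul_of_nonneg_left (hg.integral_noise_le (α := α) hK hW θ₀ hδ k) hα
  refine (integral_mono (hsq (k + τ + 1)) (by fun_prop) fun ω =>
    hg.norm_markovSA_sub_sq_le hK hν hα θ₀ (fun t => W t ω) k τ).trans ?_
  rw [integral_add (by fun_prop) (by fun_prop), integral_add (by fun_prop) (by fun_prop),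
    integral_const_mul, integral_const_mul, integral_const_mul,
    integral_add (by fun_prop) (by fun_prop), integral_add (by fun_prop) (by fun_prop),
    integral_finsetSum _ fun j _ => by fun_prop]
  have hsum : ∀ j, ∫ ω, (5 * ‖markovSA g α θ₀ (fun t => W t ω) (k + j) - θstar‖ ^ 2
      + 4 * ‖markovSA g α θ₀ (fun t => W t ω) (k + τ) - θstar‖ ^ 2
      + 4 * ‖markovSA g α θ₀ (fun t => W t ω) k - θstar‖ ^ 2 + 7 * c ^ 2) ∂Q
      = 5 * meanSqDist Q g α θ₀ θstar W (k + j) + 4 * meanSqDist Q g α θ₀ θstar W (k + τ)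
        + 4 * meanSqDist Q g α θ₀ θstar W k + 7 * c ^ 2 := fun j => by
    rw [integral_add (by fun_prop) (by fun_prop), integral_add (by fun_prop) (by fun_prop),
      integral_add (by fun_prop) (by fun_prop), integral_const_mul, integral_const_mul,
      integral_const_mul, integral_const, probReal_univ, one_smul]
    rfl
  simp only [hsum, integral_const_mul, integral_const, probReal_univ, one_smul]
  unfold meanSqDist at hnoise_le ⊢
  linarith

lemma IsDissipativeUpdate.meanSqDist_succ_le_of_le (hg : IsDissipativeUpdate K ν g M c η θstar)
    (hK : K ∈ rowStochastic ℝ Z) (hν : ν ∈ stdSimplex ℝ Z) (hW : IsMarkovChain Q K W)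
    (hα : 0 ≤ α) (θ₀ : E) {τ : ℕ} {δ : ℝ} (hδ : ∀ z, l1Dist K ν τ z ≤ δ) {b : ℝ} {k : ℕ}
    (hb : ∀ t ≤ k + τ, meanSqDist Q g α θ₀ θstar W t ≤ b) :
    meanSqDist Q g α θ₀ θstar W (k + τ + 1)
      ≤ (1 - 2 * α * η) * meanSqDist Q g α θ₀ θstar W (k + τ)
        + (α * (δ * M * (3 * b + c ^ 2))
          + α ^ 2 * M ^ 2 * (τ * (13 * b + 7 * c ^ 2) + 2 * b + 2 * c ^ 2)) := by
  have hM := hg.lipschitz_nonneg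
  obtain ⟨z, -⟩ := exists_pos_of_mem_stdSimplex hν
  have hδ0 : 0 ≤ δ := (Finset.sum_nonneg fun _ _ => abs_nonneg _).trans (hδ z)
  have hk := hb k (by omega)
  have hkτ := hb (k + τ) le_rfl
  have hsum : ∑ j ∈ Finset.range τ, (5 * meanSqDist Q g α θ₀ θstar W (k + j)
      + 4 * meanSqDist Q g α θ₀ θstar W (k + τ) + 4 * meanSqDist Q g α θ₀ θstar W k + 7 * c ^ 2)
      ≤ τ * (13 * b + 7 * c ^ 2) := by
    refine (Finset.sum_le_card_nsmul _ _ (13 * b + 7 * c ^ 2) fun j hj => ?_).trans_eq ?_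
    · linarith [hb (k + j) (by have := Finset.mem_range.1 hj; omega)]
    · rw [Finset.card_range, nsmul_eq_mul]
  refine (hg.meanSqDist_succ_le hK hν hW hα θ₀ hδ k).trans ?_
  rw [add_assoc]
  gcongr

theorem IsDissipativeUpdate.meanSqDist_le (hg : IsDissipativeUpdate K ν g M c η θstar)
    (hK : K ∈ rowStochastic ℝ Z) (hν : ν ∈ stdSimplex ℝ Z) (hW : IsMarkovChain Q K W)
    (hα : 0 < α) (hη : 0 < η) {θ₀ : E} {τ : ℕ} {δ B D : ℝ} (hδ : ∀ z, l1Dist K ν τ z ≤ δ)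
    (hB : 2 * ‖θ₀ - θstar‖ + c = B) (hτ : α * M * τ ≤ Real.log 2) (hαη : 2 * α * η ≤ 1)
    (hD : α * (δ * M * (3 * B ^ 2 + c ^ 2))
      + α ^ 2 * M ^ 2 * (τ * (13 * B ^ 2 + 7 * c ^ 2) + 2 * B ^ 2 + 2 * c ^ 2) ≤ D)
    (hD0 : 0 ≤ D) (hDB : D ≤ 2 * α * η * B ^ 2) (n : ℕ) :
    meanSqDist Q g α θ₀ θstar W (n + τ)
      ≤ Real.exp (-(2 * α * η * n)) * B ^ 2 + D / (2 * α * η) := by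
  have hinit : ∀ t ≤ τ, meanSqDist Q g α θ₀ θstar W t ≤ B ^ 2 := fun t ht =>
    hB ▸ hg.meanSqDist_le_sq hW.1 hα.le θ₀ hτ ht
  have hstep : ∀ n, (∀ t ≤ n + τ, meanSqDist Q g α θ₀ θstar W t ≤ B ^ 2) →
      meanSqDist Q g α θ₀ θstar W (n + τ + 1)
        ≤ (1 - 2 * α * η) * meanSqDist Q g α θ₀ θstar W (n + τ) + D := fun n hn =>
    (hg.meanSqDist_succ_le_of_le hK hν hW hα.le θ₀ hδ hn).trans (by gcongr)
  have hbound := forall_le_of_forall_le_imp_succ_le hinit hαη hDB hstep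
  refine le_exp_mul_add_div_of_succ_le (e := fun n => meanSqDist Q g α θ₀ θstar W (n + τ))
    (by positivity) hαη (sq_nonneg B) hD0 (hbound _) (fun n => ?_) n
  rw [Nat.succ_add_eq_add_succ]
  exact hstep n fun t _ => hbound t

end MeanSquare

end DissipativeUpdate

section ConditionNumber

variable {S : Type*} [Fintype S] {d : ℕ} {P : Matrix S S ℝ} {μ : S → ℝ}

lemma IsStationary.pos (hμ : IsStationary P μ) (hirr : P.IsIrreducible) (s : S) : 0 < μ s := by
  classical
  obtain ⟨u, hu⟩ := exists_pos_of_mem_stdSimplex hμ.1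
  obtain ⟨n, -, hn⟩ := (isIrreducible_iff_exists_pow_pos hirr.nonneg).1 hirr u s
  rw [← hμ.vecMul_pow n]
  exact Finset.sum_pos' (fun v _ => mul_nonneg (hμ.1.1 v) (pow_apply_nonneg hirr.nonneg n v s))
    ⟨u, Finset.mem_univ _, mul_pos hu hn⟩

lemma dirichletSq_nonneg (hP : ∀ i j, 0 ≤ P i j) (hμ : ∀ i, 0 ≤ μ i) (f : S → ℝ) :
    0 ≤ dirichletSq P μ f :=
  mul_nonneg one_half_pos.le (Finset.sum_nonneg fun s _ => Finset.sum_nonneg fun s' _ =>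
    mul_nonneg (mul_nonneg (hμ s) (hP s s')) (sq_nonneg _))

lemma dirichletSq_smul (c : ℝ) (f : S → ℝ) :
    dirichletSq P μ (c • f) = c ^ 2 * dirichletSq P μ f := by
  simp only [dirichletSq, Finset.mul_sum, Pi.smul_apply, smul_eq_mul]
  exact Finset.sum_congr rfl fun s _ => Finset.sum_congr rfl fun s' _ => by ring

lemma eq_of_dirichletSq_eq_zero (hμ : IsStationary P μ) (hirr : P.IsIrreducible) {f : S → ℝ}
    (hf : dirichletSq P μ f = 0) (i j : S) : f i = f j := by
  classical
  have hedge : ∀ s s', 0 < P s s' → f s = f s' := by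
    intro s s' hs
    have hterm : ∀ s s', 0 ≤ μ s * P s s' * (f s - f s') ^ 2 := fun s s' =>
      mul_nonneg (mul_nonneg (hμ.1.1 s) (hirr.nonneg s s')) (sq_nonneg _)
    have hsum := (mul_eq_zero.1 hf).resolve_left one_half_pos.ne'
    have hrow := (Finset.sum_eq_zero_iff_of_nonneg fun s _ => Finset.sum_nonneg fun s' _ =>
      hterm s s').1 hsum s (Finset.mem_univ _)
    have hzero := (Finset.sum_eq_zero_iff_of_nonneg fun s' _ => hterm s s').1 hrow s'
      (Finset.mem_univ _)
    exact sub_eq_zero.1 (pow_eq_zero_iff two_ne_zero |>.1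
      ((mul_eq_zero.1 hzero).resolve_left (mul_pos (hμ.pos hirr s) hs).ne'))
  have hpath : ∀ (n : ℕ) (s s' : S), 0 < (P ^ n) s s' → f s = f s' := by
    intro n
    induction n with
    | zero =>
      intro s s' h
      rw [pow_zero] at h
      exact congrArg f (of_not_not fun hne => h.ne' (Matrix.one_apply_ne hne))
    | succ n ih =>
      intro s s' h
      rw [pow_succ, Matrix.mul_apply] at h
      obtain ⟨u, -, hu⟩ := Finset.exists_ne_zero_of_sum_ne_zero h.ne'
      obtain ⟨hsu, hus'⟩ := mul_ne_zero_iff.1 hu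
      exact (ih s u ((pow_apply_nonneg hirr.nonneg n s u).lt_of_ne' hsu)).trans
        (hedge u s' ((hirr.nonneg u s').lt_of_ne' hus'))
  obtain ⟨n, -, hn⟩ := (isIrreducible_iff_exists_pow_pos hirr.nonneg).1 hirr i j
  exact hpath n i j hn

lemma eq_zero_of_dirichletSq_add_sq_eq_zero (hμ : IsStationary P μ) (hirr : P.IsIrreducible)
    {f : S → ℝ} (hf : dirichletSq P μ f + (μ ⬝ᵥ f) ^ 2 = 0) : f = 0 := by
  obtain ⟨hdir, hmean⟩ := (add_eq_zero_iff_of_nonneg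
    (dirichletSq_nonneg hirr.nonneg hμ.1.1 f) (sq_nonneg _)).1 hf
  have hconst := eq_of_dirichletSq_eq_zero hμ hirr hdir
  funext s
  calc f s = ∑ s', μ s' * f s' := by simp_rw [hconst _ s, ← Finset.sum_mul, hμ.1.2, one_mul]
    _ = 0 := pow_eq_zero_iff two_ne_zero |>.1 hmean

lemma conditionNumber_mul_sq_le (hP : ∀ i j, 0 ≤ P i j) (hμ : ∀ i, 0 ≤ μ i)
    (Φ : Matrix S (Fin d) ℝ) (x : EuclideanSpace ℝ (Fin d)) :
    conditionNumber P μ Φ * ‖x‖ ^ 2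
      ≤ dirichletSq P μ (Φ *ᵥ x.ofLp) + (μ ⬝ᵥ (Φ *ᵥ x.ofLp)) ^ 2 := by
  rcases eq_or_ne x 0 with rfl | hx
  · simpa using dirichletSq_nonneg hP hμ 0
  have hnorm : 0 < ‖x‖ := norm_pos_iff.2 hx
  have hbdd : BddBelow (Set.range fun x : Metric.sphere (0 : EuclideanSpace ℝ (Fin d)) 1 =>
      dirichletSq P μ (Φ *ᵥ x.1.ofLp) + (μ ⬝ᵥ (Φ *ᵥ x.1.ofLp)) ^ 2) :=
    ⟨0, Set.forall_mem_range.2 fun _ => add_nonneg (dirichletSq_nonneg hP hμ _) (sq_nonneg _)⟩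
  have hle := ciInf_le hbdd ⟨‖x‖⁻¹ • x, by simp [norm_smul, hnorm.ne']⟩
  rw [WithLp.ofLp_smul, Matrix.mulVec_smul, dirichletSq_smul, dotProduct_smul, smul_eq_mul,
    mul_pow, ← mul_add, inv_pow] at hle
  rwa [← le_div_iff₀ (pow_pos hnorm 2), div_eq_inv_mul]

lemma conditionNumber_pos (hμ : IsStationary P μ) (hirr : P.IsIrreducible)
    {Φ : Matrix S (Fin d) ℝ} (hΦ : LinearIndependent ℝ Φ.col) (hd : 0 < d) :
    0 < conditionNumber P μ Φ := by
  have : Nonempty (Fin d) := ⟨⟨0, hd⟩⟩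
  set q : EuclideanSpace ℝ (Fin d) → ℝ := fun x =>
    dirichletSq P μ (Φ *ᵥ x.ofLp) + (μ ⬝ᵥ (Φ *ᵥ x.ofLp)) ^ 2
  have hcont : Continuous q := by
    simp only [q, dirichletSq, dotProduct, Matrix.mulVec]
    fun_prop
  have hne : (Metric.sphere (0 : EuclideanSpace ℝ (Fin d)) 1).Nonempty :=
    NormedSpace.sphere_nonempty.2 zero_le_one
  obtain ⟨x, hx, hmin⟩ := (isCompact_sphere _ _).exists_isMinOn hne hcont.continuousOn
  have hpos : 0 < q x := by
    refine (add_nonneg (dirichletSq_nonneg hirr.nonneg hμ.1.1 _) (sq_nonneg _)).lt_of_ne'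
      fun h => ?_
    have hzero : x.ofLp = 0 := Matrix.mulVec_injective_iff.2 hΦ
      ((eq_zero_of_dirichletSq_add_sq_eq_zero hμ hirr h).trans (Matrix.mulVec_zero Φ).symm)
    exact ne_zero_of_mem_unit_sphere ⟨x, hx⟩ ((WithLp.ofLp_eq_zero 2).1 hzero)
  have : Nonempty (Metric.sphere (0 : EuclideanSpace ℝ (Fin d)) 1) := hne.to_subtype
  exact hpos.trans_le (le_ciInf fun y => hmin y.2)

end ConditionNumber

section MeanUpdate

variable {S : Type*} [Fintype S] [DecidableEq S] {P : Matrix S S ℝ} {μ : S → ℝ}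

lemma centering_mul (hμ : IsStationary P μ) :
    centering μ * P = P - Matrix.vecMulVec (fun _ => 1) μ := by
  rw [centering, sub_mul, one_mul, Matrix.vecMulVec_mul, hμ.2]

lemma dirichletSq_eq_dotProduct (hP : P ∈ rowStochastic ℝ S) (hμ : IsStationary P μ)
    (f : S → ℝ) : dirichletSq P μ f = f ⬝ᵥ (diagonal μ *ᵥ (f - P *ᵥ f)) := by
  have hrow : ∑ s, ∑ s', μ s * P s s' * f s ^ 2 = ∑ s, μ s * f s ^ 2 := by
    simp only [← Finset.sum_mul, ← Finset.mul_sum, sum_row_of_mem_rowStochastic hP, mul_one]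
  have hcol : ∑ s, ∑ s', μ s * P s s' * f s' ^ 2 = ∑ s, μ s * f s ^ 2 := by
    rw [Finset.sum_comm]
    simp only [← Finset.sum_mul]
    exact Finset.sum_congr rfl fun s _ => congrArg (· * f s ^ 2) (congrFun hμ.2 s)
  have hcross : ∑ s, ∑ s', μ s * P s s' * (f s * f s') = ∑ s, μ s * f s * (P *ᵥ f) s := by
    simp only [Matrix.mulVec, dotProduct, Finset.mul_sum]
    exact Finset.sum_congr rfl fun s _ => Finset.sum_congr rfl fun s' _ => by ring
  have hexpand : ∑ s, ∑ s', μ s * P s s' * (f s - f s') ^ 2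
      = ∑ s, ∑ s', μ s * P s s' * f s ^ 2 + ∑ s, ∑ s', μ s * P s s' * f s' ^ 2
        - 2 * ∑ s, ∑ s', μ s * P s s' * (f s * f s') := by
    simp only [Finset.mul_sum, ← Finset.sum_add_distrib, ← Finset.sum_sub_distrib]
    exact Finset.sum_congr rfl fun s _ => Finset.sum_congr rfl fun s' _ => by ring
  rw [dirichletSq, hexpand, hrow, hcol, hcross, ← two_mul, ← mul_sub, ← mul_assoc,
    one_div_mul_cancel two_ne_zero, one_mul, ← Finset.sum_sub_distrib]
  refine Finset.sum_congr rfl fun s _ => ?_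
  rw [Matrix.mulVec_diagonal, Pi.sub_apply]
  ring

lemma dotProduct_mulVec_one_sub_centering_mul (hP : P ∈ rowStochastic ℝ S)
    (hμ : IsStationary P μ) (f : S → ℝ) :
    f ⬝ᵥ (diagonal μ *ᵥ ((1 - centering μ * P) *ᵥ f)) = dirichletSq P μ f + (μ ⬝ᵥ f) ^ 2 := by
  have hmean : f ⬝ᵥ (diagonal μ *ᵥ fun _ => μ ⬝ᵥ f) = (μ ⬝ᵥ f) ^ 2 := by
    simp only [dotProduct, Matrix.mulVec_diagonal, sq, Finset.sum_mul]
    exact Finset.sum_congr rfl fun s _ => by ring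
  have hsplit : (1 - centering μ * P) *ᵥ f = (f - P *ᵥ f) + fun _ => μ ⬝ᵥ f := by
    rw [centering_mul hμ, Matrix.sub_mulVec, Matrix.sub_mulVec, Matrix.one_mulVec,
      Matrix.vecMulVec_mulVec]
    ext s
    simp [sub_add]
  rw [hsplit, Matrix.mulVec_add, dotProduct_add, ← dirichletSq_eq_dotProduct hP hμ, hmean]

end MeanUpdate

section DoubleChain

open scoped Kronecker

variable {S : Type*} {d : ℕ} {R : S → ℝ} {Φ : Matrix S (Fin d) ℝ} {r : ℝ}
  {θstar : EuclideanSpace ℝ (Fin d)}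

/-- The update direction `f(s, ŝ, θ) + g(s, s', θ)` of the double-chain algorithm, on a
transition from `z = (s, ŝ)` to `z' = (s', ŝ')` of the pair of chains. -/
def doubleUpdate [Fintype S] (R : S → ℝ) (Φ : Matrix S (Fin d) ℝ) (z z' : S × S)
    (θ : EuclideanSpace ℝ (Fin d)) : EuclideanSpace ℝ (Fin d) :=
  fUpdate R Φ z.1 z.2 θ + gUpdate R Φ z.1 z'.1 θ

lemma abs_inner_feature_le (hΦ : ∀ s, ‖feature Φ s‖ ≤ 1) (s : S)
    (θ : EuclideanSpace ℝ (Fin d)) : |inner ℝ (feature Φ s) θ| ≤ ‖θ‖ :=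
  (abs_real_inner_le_norm _ _).trans (mul_le_of_le_one_left (norm_nonneg _) (hΦ s))

lemma norm_smul_feature_add_smul_feature_le (hΦ : ∀ s, ‖feature Φ s‖ ≤ 1) (s s' : S)
    (a b : ℝ) : ‖a • feature Φ s + b • feature Φ s'‖ ≤ |a| + |b| := by
  refine (norm_add_le _ _).trans (add_le_add ?_ ?_) <;>
  · rw [norm_smul, Real.norm_eq_abs]
    exact mul_le_of_le_one_right (abs_nonneg _) (hΦ _)

lemma mulVec_eq_inner_feature (Φ : Matrix S (Fin d) ℝ) (x : EuclideanSpace ℝ (Fin d)) (s : S) :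
    (Φ *ᵥ x.ofLp) s = inner ℝ (feature Φ s) x := by
  simp [Matrix.mulVec, dotProduct, feature, PiLp.inner_apply, mul_comm]

variable [Fintype S]

lemma isLipschitzUpdate_doubleUpdate (hΦ : ∀ s, ‖feature Φ s‖ ≤ 1) (hr : 0 ≤ r)
    (hR : ∀ s, |R s| ≤ r) (θstar : EuclideanSpace ℝ (Fin d)) :
    IsLipschitzUpdate (doubleUpdate R Φ) 3 (r + ‖θstar‖) θstar where
  lipschitz_nonneg := zero_le_three
  bound_nonneg := add_nonneg hr (norm_nonneg _)
  lipschitz z z' θ θ' := by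
    have hsub : doubleUpdate R Φ z z' θ - doubleUpdate R Φ z z' θ'
        = (-inner ℝ (feature Φ z.1) (θ - θ')) • feature Φ z.2
          + (inner ℝ (feature Φ z'.1) (θ - θ') - inner ℝ (feature Φ z.1) (θ - θ'))
            • feature Φ z.1 := by
      simp only [doubleUpdate, fUpdate, gUpdate, inner_sub_right]
      module
    have h := abs_inner_feature_le hΦ z.1 (θ - θ')
    have h' := abs_inner_feature_le hΦ z'.1 (θ - θ')
    rw [hsub]
    refine (norm_smul_feature_add_smul_feature_le hΦ _ _ _ _).trans ?_
    rw [abs_neg]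
    linarith [abs_sub (inner ℝ (feature Φ z'.1) (θ - θ')) (inner ℝ (feature Φ z.1) (θ - θ'))]
  norm_apply_star_le z z' := by
    have h := abs_inner_feature_le hΦ z.1 θstar
    have h' := abs_inner_feature_le hΦ z'.1 θstar
    have hr' := hR z.1
    rw [doubleUpdate, fUpdate, gUpdate, ← neg_smul]
    refine (norm_smul_feature_add_smul_feature_le hΦ _ _ _ _).trans ?_
    rw [abs_neg, add_sub_assoc]
    linarith [abs_add_le (R z.1) (inner ℝ (feature Φ z.1) θstar),
      abs_add_le (R z.1) (inner ℝ (feature Φ z'.1) θstar - inner ℝ (feature Φ z.1) θstar),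
      abs_sub (inner ℝ (feature Φ z'.1) θstar) (inner ℝ (feature Φ z.1) θstar)]

lemma doubleChain_eq_markovSA (R : S → ℝ) (Φ : Matrix S (Fin d) ℝ) (α : ℝ)
    (θ₀ : EuclideanSpace ℝ (Fin d)) (s sHat : ℕ → S) (t : ℕ) :
    doubleChain R Φ (fun _ => α) θ₀ s sHat t
      = markovSA (doubleUpdate R Φ) α θ₀ (fun t => (s t, sHat t)) t := by
  induction t with
  | zero => rfl
  | succ t ih => rw [doubleChain, markovSA, ih, doubleUpdate]

lemma meanSqError_eq_meanSqDist {Ω : Type*} [MeasurableSpace Ω] (Q : Measure Ω) (R : S → ℝ)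
    (Φ : Matrix S (Fin d) ℝ) (α : ℝ) (θ₀ θstar : EuclideanSpace ℝ (Fin d))
    (s sHat : ℕ → Ω → S) (T : ℕ) :
    meanSqError Q R Φ α θ₀ θstar s sHat T
      = meanSqDist Q (doubleUpdate R Φ) α θ₀ θstar (fun t ω => (s t ω, sHat t ω)) T := by
  simp only [meanSqError, meanSqDist, doubleChain_eq_markovSA]

lemma sum_smul_feature (Φ : Matrix S (Fin d) ℝ) (c : S → ℝ) :
    ∑ s, c s • feature Φ s = WithLp.toLp 2 (Φᵀ *ᵥ c) := by
  ext i
  simp [feature, Matrix.mulVec, dotProduct, mul_comm]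

variable [DecidableEq S] {P : Matrix S S ℝ} {μ : S → ℝ}

lemma sum_kronecker_smul_doubleUpdate (hP : P ∈ rowStochastic ℝ S) (z : S × S)
    (θ : EuclideanSpace ℝ (Fin d)) :
    ∑ z', (P ⊗ₖ P) z z' • doubleUpdate R Φ z z' θ
      = -((R + Φ *ᵥ θ.ofLp) z.1) • feature Φ z.2
        + (R + P *ᵥ (Φ *ᵥ θ.ofLp) - Φ *ᵥ θ.ofLp) z.1 • feature Φ z.1 := by
  have hrow := sum_row_of_mem_rowStochastic hP
  set f : S → ℝ := Φ *ᵥ θ.ofLp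
  have hg : ∑ a, P z.1 a • gUpdate R Φ z.1 a θ = (R + P *ᵥ f - f) z.1 • feature Φ z.1 := by
    simp only [gUpdate, ← mulVec_eq_inner_feature, smul_smul, ← Finset.sum_smul, mul_sub, mul_add,
      Finset.sum_sub_distrib, Finset.sum_add_distrib, ← Finset.sum_mul, hrow, one_mul]
    rfl
  simp only [Fintype.sum_prod_type, kroneckerMap_apply, mul_smul, ← Finset.smul_sum,
    ← Finset.sum_smul, doubleUpdate, hrow, one_smul, smul_add, Finset.sum_add_distrib, hg]
  rw [fUpdate, neg_smul, ← mulVec_eq_inner_feature]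
  rfl

lemma edgeMean_doubleUpdate (hP : P ∈ rowStochastic ℝ S) (hμ : IsStationary P μ)
    (θ : EuclideanSpace ℝ (Fin d)) :
    edgeMean (P ⊗ₖ P) (fun z => μ z.1 * μ z.2) (fun z z' => doubleUpdate R Φ z z' θ)
      = WithLp.toLp 2 ((Φᵀ * diagonal μ * centering μ) *ᵥ R
        - (Φᵀ * diagonal μ * (1 - centering μ * P) * Φ) *ᵥ θ.ofLp) := by
  set f : S → ℝ := Φ *ᵥ θ.ofLp with hf
  have hcentered : centering μ *ᵥ R - (1 - centering μ * P) *ᵥ f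
      = fun a => (R + P *ᵥ f - f) a - μ ⬝ᵥ (R + f) := by
    rw [centering_mul hμ, centering]
    ext a
    simp only [Matrix.sub_mulVec, Matrix.one_mulVec, Matrix.vecMulVec_mulVec, dotProduct_add,
      Pi.sub_apply, Pi.add_apply, Pi.smul_apply, MulOpposite.smul_eq_mul_unop,
      MulOpposite.unop_op, one_mul]
    ring
  have hf_mean : ∑ a, ∑ b, (μ a * μ b) • -((R + f) a) • feature Φ b
      = ∑ b, (μ b * -(μ ⬝ᵥ (R + f))) • feature Φ b := by
    rw [Finset.sum_comm]
    simp only [smul_smul, ← Finset.sum_smul, dotProduct, ← Finset.sum_neg_distrib, Finset.mul_sum]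
    exact Finset.sum_congr rfl fun b _ => congrArg (· • feature Φ b)
      (Finset.sum_congr rfl fun a _ => by ring)
  have hg_mean : ∑ a, ∑ b, (μ a * μ b) • (R + P *ᵥ f - f) a • feature Φ a
      = ∑ a, (μ a * (R + P *ᵥ f - f) a) • feature Φ a := by
    simp only [mul_smul, ← Finset.smul_sum, ← Finset.sum_smul, hμ.1.2, one_smul]
  calc edgeMean (P ⊗ₖ P) (fun z => μ z.1 * μ z.2) (fun z z' => doubleUpdate R Φ z z' θ)
      = ∑ a, ∑ b, (μ a * μ b) • (-((R + f) a) • feature Φ b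
          + (R + P *ᵥ f - f) a • feature Φ a) := by
        simp only [edgeMean, sum_kronecker_smul_doubleUpdate hP, Fintype.sum_prod_type]
        rfl
    _ = ∑ a, (diagonal μ *ᵥ (centering μ *ᵥ R - (1 - centering μ * P) *ᵥ f)) a
          • feature Φ a := by
        simp only [smul_add, Finset.sum_add_distrib, hf_mean, hg_mean, hcentered,
          Matrix.mulVec_diagonal, mul_sub, sub_smul, Finset.sum_sub_distrib]
        simp only [mul_neg, neg_smul, Finset.sum_neg_distrib, neg_add_eq_sub]
    _ = _ := by
        rw [sum_smul_feature, Matrix.mulVec_sub, Matrix.mulVec_sub]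
        simp only [hf, Matrix.mulVec_mulVec, Matrix.mul_assoc]

lemma isDissipativeUpdate_doubleUpdate (hP : P ∈ rowStochastic ℝ S) (hμ : IsStationary P μ)
    (hΦ : ∀ s, ‖feature Φ s‖ ≤ 1) (hr : 0 ≤ r) (hR : ∀ s, |R s| ≤ r)
    (hθ : IsFixedPoint P μ R Φ θstar) :
    IsDissipativeUpdate (P ⊗ₖ P) (fun z => μ z.1 * μ z.2) (doubleUpdate R Φ) 3 (r + ‖θstar‖)
      (conditionNumber P μ Φ) θstar where
  toIsLipschitzUpdate := isLipschitzUpdate_doubleUpdate hΦ hr hR θstar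
  mean_star_eq_zero := by rw [edgeMean_doubleUpdate hP hμ, hθ, sub_self, WithLp.toLp_zero]
  inner_mean_le θ := by
    have hmean : (Φᵀ * diagonal μ * centering μ) *ᵥ R
        - (Φᵀ * diagonal μ * (1 - centering μ * P) * Φ) *ᵥ θ.ofLp
        = -((Φᵀ * diagonal μ * (1 - centering μ * P) * Φ) *ᵥ (θ - θstar).ofLp) := by
      rw [← hθ, WithLp.ofLp_sub, Matrix.mulVec_sub, neg_sub]
    have hquad : (θ - θstar).ofLp
        ⬝ᵥ ((Φᵀ * diagonal μ * (1 - centering μ * P) * Φ) *ᵥ (θ - θstar).ofLp)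
        = dirichletSq P μ (Φ *ᵥ (θ - θstar).ofLp) + (μ ⬝ᵥ (Φ *ᵥ (θ - θstar).ofLp)) ^ 2 := by
      rw [← dotProduct_mulVec_one_sub_centering_mul hP hμ]
      simp only [Matrix.dotProduct_mulVec, ← Matrix.vecMul_vecMul, Matrix.vecMul_transpose]
    rw [edgeMean_doubleUpdate hP hμ, hmean, WithLp.toLp_neg, inner_neg_right, neg_le_neg_iff,
      real_inner_comm, EuclideanSpace.inner_eq_star_dotProduct, star_trivial, hquad]
    exact conditionNumber_mul_sq_le (fun i j => nonneg_of_mem_rowStochastic hP) hμ.1.1 Φ _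

end DoubleChain

section FiniteTime

open scoped Kronecker

lemma MDP.rMax_nonneg {S A : Type*} [Fintype S] (M : MDP S A) : 0 ≤ M.rMax :=
  Real.iSup_nonneg fun _ => abs_nonneg _

lemma MDP.abs_expReward_le {S A : Type*} [Fintype S] [Fintype A] (M : MDP S A) (π : Policy S A)
    (s : S) : |M.expReward π s| ≤ M.rMax := by
  have hreward : ∀ a, |M.reward s a| ≤ M.rMax := fun a =>
    le_ciSup (f := fun p : S × A => |M.reward p.1 p.2|) (Set.finite_range _).bddAbove (s, a)
  calc |M.expReward π s| ≤ ∑ a, |π.prob s a * M.reward s a| := Finset.abs_sum_le_sum_abs _ _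
    _ ≤ ∑ a, π.prob s a * M.rMax := by
        refine Finset.sum_le_sum fun a _ => ?_
        rw [abs_mul, abs_of_nonneg ((π.prob_mem s).1 a)]
        exact mul_le_mul_of_nonneg_left (hreward a) ((π.prob_mem s).1 a)
    _ = M.rMax := by rw [← Finset.sum_mul, (π.prob_mem s).2, one_mul]

variable {d : ℕ} (r : ℝ) (θ₀ θstar : EuclideanSpace ℝ (Fin d))

lemma constG_nonneg : 0 ≤ constG r θ₀ θstar := by
  unfold constG
  positivity

lemma mul_constB_sq_le_constG : 42 * constB r θ₀ θstar ^ 2 ≤ constG r θ₀ θstar :=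
  le_add_of_nonneg_right (by positivity)

variable {r} in
lemma constG_le (hr : 0 ≤ r) : constG r θ₀ θstar ≤ 72 * constB r θ₀ θstar ^ 2 := by
  have hc : r + ‖θstar‖ ≤ constB r θ₀ θstar := by
    rw [constB, add_assoc]
    exact le_add_of_nonneg_left (by positivity)
  have hsq := pow_le_pow_left₀ (by positivity) hc 2
  rw [constG]
  linarith

variable {r θstar}
variable {S Ω : Type*} [Fintype S] [DecidableEq S] [MeasurableSpace S]
  [MeasurableSingletonClass S] [MeasurableSpace Ω] {Q : Measure Ω} [IsProbabilityMeasure Q]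
  {P : Matrix S S ℝ} {μ R : S → ℝ} {Φ : Matrix S (Fin d) ℝ} {η α : ℝ} {s sHat : ℕ → Ω → S}
  {τ T : ℕ}

lemma meanSqError_le
    (hg : IsDissipativeUpdate (P ⊗ₖ P) (fun z => μ z.1 * μ z.2) (doubleUpdate R Φ) 3
      (r + ‖θstar‖) η θstar)
    (hη : 0 < η) (hη3 : η ≤ 3) (hP : P ∈ rowStochastic ℝ S) (hμ : IsStationary P μ)
    (hs : IsMarkovChain Q P s) (hsHat : IsMarkovChain Q P sHat)
    (hind : IndepFun (fun ω t => s t ω) (fun ω t => sHat t ω) Q) (hα : 0 < α)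
    (hτ : ∀ s, l1Dist P μ τ s ≤ α) (hαη : 42 * (α * (3 * τ + 1)) ≤ η)
    (hαB : α * (3 * τ + 1) * constG r θ₀ θstar ≤ η * constB r θ₀ θstar ^ 2) (hT : τ ≤ T) :
    meanSqError Q R Φ α θ₀ θstar s sHat T
      ≤ Real.exp (-2 * α * η * ((T : ℝ) - τ)) * constB r θ₀ θstar ^ 2
        + α * constG r θ₀ θstar * (3 * (τ : ℝ) + 1) / (2 * η) := by
  obtain ⟨n, rfl⟩ := Nat.exists_eq_add_of_le' hT
  set B := constB r θ₀ θstar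
  set G := constG r θ₀ θstar
  have hG : 0 ≤ G := constG_nonneg r θ₀ θstar
  have hατ : 0 ≤ α * τ := by positivity
  have hδ : ∀ z, l1Dist (P ⊗ₖ P) (fun z => μ z.1 * μ z.2) τ z ≤ 2 * α := fun z =>
    (l1Dist_kronecker_le hP hμ.1 τ z).trans (by linarith [hτ z.1, hτ z.2])
  have hlog : α * 3 * τ ≤ Real.log 2 := by linarith [Real.log_two_gt_d9]
  have hcontr : 2 * α * η ≤ 1 := by nlinarith
  have hdrift : α * (2 * α * 3 * (3 * B ^ 2 + (r + ‖θstar‖) ^ 2))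
      + α ^ 2 * 3 ^ 2 * (τ * (13 * B ^ 2 + 7 * (r + ‖θstar‖) ^ 2) + 2 * B ^ 2
        + 2 * (r + ‖θstar‖) ^ 2) ≤ α ^ 2 * (3 * τ + 1) * G := by
    have hgap : 0 ≤ α ^ 2 * (6 * B ^ 2 + 6 * (r + ‖θstar‖) ^ 2
        + τ * (9 * B ^ 2 + 27 * (r + ‖θstar‖) ^ 2)) := by positivity
    have hGB : G = 42 * B ^ 2 + 30 * (r + ‖θstar‖) ^ 2 := rfl
    rw [hGB]
    linarith
  have hDB : α ^ 2 * (3 * τ + 1) * G ≤ 2 * α * η * B ^ 2 := by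
    have hηB : 0 ≤ η * B ^ 2 := by positivity
    linarith [mul_le_mul_of_nonneg_left hαB hα.le, mul_nonneg hα.le hηB]
  have hB : 2 * ‖θ₀ - θstar‖ + (r + ‖θstar‖) = B := (add_assoc _ _ _).symm
  have hmain := hg.meanSqDist_le (kronecker_mem_rowStochastic hP hP)
    (mul_mem_stdSimplex hμ.1 hμ.1) (hs.prodMk hsHat hind) hα hη hδ hB hlog
    hcontr hdrift (by positivity) hDB n
  rw [meanSqError_eq_meanSqDist]
  convert hmain using 2
  · push_cast
    ring_nf
  · field_simp

lemma meanSqError_le_of_le_div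
    (hg : IsDissipativeUpdate (P ⊗ₖ P) (fun z => μ z.1 * μ z.2) (doubleUpdate R Φ) 3
      (r + ‖θstar‖) η θstar)
    (hη : 0 < η) (hη3 : η ≤ 3) (hP : P ∈ rowStochastic ℝ S) (hμ : IsStationary P μ)
    (hs : IsMarkovChain Q P s) (hsHat : IsMarkovChain Q P sHat)
    (hind : IndepFun (fun ω t => s t ω) (fun ω t => sHat t ω) Q) (hα : 0 < α)
    (hτ : ∀ s, l1Dist P μ τ s ≤ α)
    (hstep : α ≤ η * constB r θ₀ θstar ^ 2 / ((3 * (τ : ℝ) + 1) * constG r θ₀ θstar))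
    (hT : τ ≤ T) :
    meanSqError Q R Φ α θ₀ θstar s sHat T
      ≤ Real.exp (-2 * α * η * ((T : ℝ) - τ)) * constB r θ₀ θstar ^ 2
        + α * constG r θ₀ θstar * (3 * (τ : ℝ) + 1) / (2 * η) := by
  have hG : 0 < constG r θ₀ θstar := by
    refine (constG_nonneg r θ₀ θstar).lt_of_ne' fun h => hα.not_ge ?_
    simpa only [h, mul_zero, div_zero] using hstep
  have hαB : α * (3 * τ + 1) * constG r θ₀ θstar ≤ η * constB r θ₀ θstar ^ 2 := by
    rwa [le_div_iff₀ (by positivity), ← mul_assoc] at hstep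
  have hB : 0 < constB r θ₀ θstar ^ 2 :=
    pos_of_mul_pos_right ((by positivity : 0 < α * (3 * τ + 1) * constG r θ₀ θstar).trans_le hαB)
      hη.le
  have hαη : 42 * (α * (3 * τ + 1)) ≤ η := by
    refine le_of_mul_le_mul_right ?_ hB
    linarith [mul_le_mul_of_nonneg_left (mul_constB_sq_le_constG r θ₀ θstar)
      (by positivity : 0 ≤ α * (3 * τ + 1))]
  exact meanSqError_le θ₀ hg hη hη3 hP hμ hs hsHat hind hα hτ hαη hαB hT

end FiniteTime

section Rate

open scoped Kronecker

lemma one_le_mixingFactor (C β : ℝ) : 1 ≤ mixingFactor C β := le_max_left _ _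

lemma le_log_of_two_le {x : ℝ} (hx : 2 ≤ x) : 0.69 ≤ Real.log x := by
  linarith [Real.log_le_log two_pos hx, Real.log_two_gt_d9]

lemma mul_pow_ceil_mixingFactor_le {C β x : ℝ} (hC : 1 < C) (hβ0 : 0 ≤ β) (hβ1 : β < 1)
    (hx : 1 ≤ x) : C * β ^ ⌈mixingFactor C β * x⌉₊ ≤ Real.exp (-x) := by
  have hLx : 0 < mixingFactor C β * x :=
    mul_pos (one_pos.trans_le (one_le_mixingFactor C β)) (one_pos.trans_le hx)
  rcases hβ0.eq_or_lt with rfl | hβ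
  · rw [zero_pow (Nat.ceil_pos.2 hLx).ne', mul_zero]
    exact (Real.exp_pos _).le
  have hlogβ : 0 < Real.log (1 / β) := Real.log_pos (one_lt_one_div hβ hβ1)
  have hexponent : Real.log C + x ≤ ⌈mixingFactor C β * x⌉₊ * Real.log (1 / β) :=
    calc Real.log C + x ≤ (Real.log C + 1) * x := by
          linarith [mul_le_mul_of_nonneg_left hx (Real.log_pos hC).le]
      _ ≤ mixingFactor C β * Real.log (1 / β) * x := by
          gcongr
          exact (div_le_iff₀ hlogβ).1 (le_max_right _ _)
      _ = mixingFactor C β * x * Real.log (1 / β) := by ring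
      _ ≤ ⌈mixingFactor C β * x⌉₊ * Real.log (1 / β) := by
          gcongr
          exact Nat.le_ceil _
  rw [one_div, Real.log_inv] at hexponent
  rw [← Real.exp_log (one_pos.trans hC), ← Real.exp_log hβ, ← Real.exp_nat_mul, ← Real.exp_add,
    Real.exp_log (one_pos.trans hC), Real.exp_log hβ]
  exact Real.exp_le_exp.2 (by linarith)

variable {S : Type*} [Fintype S] [DecidableEq S] {P : Matrix S S ℝ} {μ : S → ℝ} {C β : ℝ}

lemma IsGeometricMixing.mixingTime_le (h : IsGeometricMixing P μ C β) {x ε : ℝ} (hx : 1 ≤ x)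
    (hε : Real.exp (-x) ≤ ε) : (mixingTime P μ ε : ℝ) ≤ mixingFactor C β * x + 1 := by
  obtain ⟨hC, hβ0, hβ1, hdist⟩ := h
  have hLx : 0 ≤ mixingFactor C β * x :=
    mul_nonneg (zero_le_one.trans (one_le_mixingFactor C β)) (zero_le_one.trans hx)
  have hceil : mixingTime P μ ε ≤ ⌈mixingFactor C β * x⌉₊ := Nat.sInf_le fun s =>
    (hdist _ s).trans ((mul_pow_ceil_mixingFactor_le hC hβ0 hβ1 hx).trans hε)
  exact (Nat.cast_le.2 hceil).trans (Nat.ceil_lt_add_one hLx).le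

lemma IsGeometricMixing.mixingTime_log_div_le (h : IsGeometricMixing P μ C β) {η : ℝ}
    (hη : 0 < η) (hη3 : η ≤ 3) {T : ℝ} (hT : 2 ≤ T) :
    (mixingTime P μ (Real.log T / (η * T)) : ℝ) ≤ 6 * mixingFactor C β * Real.log T := by
  have hT0 : 0 < T := two_pos.trans_le hT
  have hlog := le_log_of_two_le hT
  have hL := one_le_mixingFactor C β
  have hexp : 5 ≤ Real.exp 2 := by
    linarith [Real.quadratic_le_exp_of_nonneg (x := 2) zero_le_two]
  have hα : Real.exp (-(Real.log T + 2)) ≤ Real.log T / (η * T) := by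
    rw [neg_add, Real.exp_add, Real.exp_neg, Real.exp_neg, Real.exp_log hT0,
      le_div_iff₀ (by positivity), ← mul_inv, inv_mul_le_iff₀ (by positivity)]
    nlinarith [mul_le_mul hexp hlog (by norm_num) (Real.exp_pos 2).le]
  have hmix := h.mixingTime_le (by linarith) hα
  nlinarith [mul_le_mul_of_nonneg_left hlog (zero_le_one.trans hL)]

lemma exp_neg_two_mul_log_mul_le {T τ : ℝ} (hT : 0 < T) (hτ : 2 * (τ * Real.log T) ≤ T) :
    Real.exp (-(2 * Real.log T * (T - τ) / T)) ≤ 3 / T ^ 2 := by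
  have hsplit : -(2 * Real.log T * (T - τ) / T)
      = 2 * (τ * Real.log T) / T + -(2 * Real.log T) := by
    field_simp
    ring
  have hone : Real.exp (2 * (τ * Real.log T) / T) ≤ 3 :=
    (Real.exp_le_exp.2 ((div_le_one hT).2 hτ)).trans (by linarith [Real.exp_one_lt_d9])
  rw [hsplit, Real.exp_add, Real.exp_neg, two_mul (Real.log T), Real.exp_add, Real.exp_log hT,
    ← sq, div_eq_mul_inv]
  exact mul_le_mul_of_nonneg_right hone (by positivity)

lemma log_div_mul_le {L η T τ : ℝ} (hL : 1 ≤ L) (hη : 0 < η) (hT : 2 ≤ T)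
    (hτ : τ ≤ 6 * L * Real.log T) :
    Real.log T / (η * T) * (3 * τ + 1) ≤ 20 * (L * Real.log T ^ 2) / (η * T) := by
  have hlog := le_log_of_two_le hT
  have hτL : 3 * τ + 1 ≤ 20 * L * Real.log T := by
    nlinarith [mul_le_mul_of_nonneg_left hlog (zero_le_one.trans hL)]
  calc Real.log T / (η * T) * (3 * τ + 1)
      ≤ Real.log T / (η * T) * (20 * L * Real.log T) := by gcongr
    _ = 20 * (L * Real.log T ^ 2) / (η * T) := by ring

lemma log_div_mul_le_div {L η T τ : ℝ} (hL : 1 ≤ L) (hη : 0 < η) (hT : 2 ≤ T)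
    (hτ : τ ≤ 6 * L * Real.log T) (hLT : 2000 * L / η ^ 2 * Real.log T ^ 2 ≤ T) :
    Real.log T / (η * T) * (3 * τ + 1) ≤ η / 100 := by
  have hT0 : 0 < T := two_pos.trans_le hT
  refine (log_div_mul_le hL hη hT hτ).trans ?_
  rw [div_mul_eq_mul_div, div_le_iff₀ (by positivity)] at hLT
  rw [div_le_div_iff₀ (by positivity) (by norm_num)]
  linarith

lemma mul_log_le_div {L η T τ : ℝ} (hη : 0 < η) (hη3 : η ≤ 3) (hT : 2 ≤ T)
    (hτ : τ ≤ 6 * L * Real.log T) (hLT : 2000 * L / η ^ 2 * Real.log T ^ 2 ≤ T) :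
    τ * Real.log T ≤ T / 9 := by
  have hlog := le_log_of_two_le hT
  have hηsq : η ^ 2 ≤ 9 := (pow_le_pow_left₀ hη.le hη3 2).trans (by norm_num)
  rw [div_mul_eq_mul_div, div_le_iff₀ (by positivity)] at hLT
  linarith [mul_le_mul_of_nonneg_right hτ (by linarith : 0 ≤ Real.log T),
    mul_le_mul_of_nonneg_left hηsq (by linarith : 0 ≤ T)]

lemma exp_mul_add_le_rate {B G L η T τ : ℝ} (hG : 0 ≤ G) (hBG : 42 * B ^ 2 ≤ G) (hL : 1 ≤ L)
    (hη : 0 < η) (hη3 : η ≤ 3) (hT : 2 ≤ T) (hτ : τ ≤ 6 * L * Real.log T)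
    (hτT : 2 * (τ * Real.log T) ≤ T) :
    Real.exp (-2 * (Real.log T / (η * T)) * η * (T - τ)) * B ^ 2
        + Real.log T / (η * T) * G * (3 * τ + 1) / (2 * η)
      ≤ 11 * G * L / η ^ 2 * (Real.log T ^ 2 / T) := by
  have hT0 : 0 < T := two_pos.trans_le hT
  have hlog := le_log_of_two_le hT
  have hexp : Real.exp (-2 * (Real.log T / (η * T)) * η * (T - τ)) ≤ 3 / T ^ 2 := by
    convert exp_neg_two_mul_log_mul_le hT0 hτT using 2
    field_simp
  have hηL : η ^ 2 ≤ 14 * (L * Real.log T ^ 2) * T := by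
    have hlogsq : 0.69 ^ 2 ≤ Real.log T ^ 2 := pow_le_pow_left₀ (by norm_num) hlog 2
    have hLlog : 0.69 ^ 2 ≤ L * Real.log T ^ 2 :=
      hlogsq.trans (le_mul_of_one_le_left (sq_nonneg _) hL)
    nlinarith
  have hbias : Real.exp (-2 * (Real.log T / (η * T)) * η * (T - τ)) * B ^ 2
      ≤ G * L / η ^ 2 * (Real.log T ^ 2 / T) :=
    calc _ ≤ 3 / T ^ 2 * (G / 42) :=
          mul_le_mul hexp (by linarith) (sq_nonneg B) (by positivity)
      _ = G / (14 * T ^ 2 * η ^ 2) * η ^ 2 := by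
          field_simp
          ring
      _ ≤ G / (14 * T ^ 2 * η ^ 2) * (14 * (L * Real.log T ^ 2) * T) := by gcongr
      _ = G * L / η ^ 2 * (Real.log T ^ 2 / T) := by field_simp
  have hnoise : Real.log T / (η * T) * G * (3 * τ + 1) / (2 * η)
      ≤ 10 * (G * L / η ^ 2 * (Real.log T ^ 2 / T)) :=
    calc Real.log T / (η * T) * G * (3 * τ + 1) / (2 * η)
        = Real.log T / (η * T) * (3 * τ + 1) * (G / (2 * η)) := by ring
      _ ≤ 20 * (L * Real.log T ^ 2) / (η * T) * (G / (2 * η)) :=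
          mul_le_mul_of_nonneg_right (log_div_mul_le hL hη hT hτ) (by positivity)
      _ = 10 * (G * L / η ^ 2 * (Real.log T ^ 2 / T)) := by
          field_simp
          ring
  calc _ ≤ G * L / η ^ 2 * (Real.log T ^ 2 / T)
          + 10 * (G * L / η ^ 2 * (Real.log T ^ 2 / T)) := add_le_add hbias hnoise
    _ = 11 * G * L / η ^ 2 * (Real.log T ^ 2 / T) := by ring

lemma log_sq_le_mul_sqrt {u : ℝ} (hu : 1 ≤ u) : Real.log u ^ 2 ≤ 16 * √u := by
  have hu0 : 0 ≤ u := zero_le_one.trans hu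
  have hlog := Real.log_le_rpow_div hu0 (by norm_num : (0 : ℝ) < 1 / 4)
  calc Real.log u ^ 2 ≤ (u ^ (1 / 4 : ℝ) / (1 / 4)) ^ 2 :=
        pow_le_pow_left₀ (Real.log_nonneg hu) hlog 2
    _ = 16 * (u ^ (1 / 4 : ℝ)) ^ 2 := by ring
    _ = 16 * √u := by
        rw [← Real.rpow_mul_natCast hu0, Real.sqrt_eq_rpow]
        norm_num

lemma mul_log_sq_le_of_le {N T : ℝ} (hN : 1 / 9 ≤ N)
    (hT : 10 ^ 11 * N * Real.log (2 + N) ^ 2 ≤ T) : 2 ≤ T ∧ 2000 * N * Real.log T ^ 2 ≤ T := by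
  have hN0 : 0 < N := by linarith
  have hlogsq : 0.69 ^ 2 ≤ Real.log (2 + N) ^ 2 :=
    pow_le_pow_left₀ (by norm_num) (le_log_of_two_le (by linarith)) 2
  obtain ⟨u, rfl⟩ : ∃ u, T = u * N := ⟨T / N, by field_simp⟩
  have hu : 10 ^ 11 * Real.log (2 + N) ^ 2 ≤ u := by
    refine le_of_mul_le_mul_right ?_ hN0
    linarith
  have hu_large : 10 ^ 10 ≤ u := by linarith
  have hTwo : 2 ≤ u * N := by nlinarith
  refine ⟨hTwo, ?_⟩
  have hsqrt : 10 ^ 5 ≤ √u := Real.le_sqrt_of_sq_le (by linarith only [hu_large])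
  have hlogT : Real.log (u * N) ≤ Real.log u + Real.log (2 + N) := by
    rw [Real.log_mul (by linarith) hN0.ne']
    exact add_le_add_right (Real.log_le_log hN0 (by linarith)) _
  have hlogTsq : Real.log (u * N) ^ 2 ≤ 32 * √u + 2 * Real.log (2 + N) ^ 2 :=
    calc Real.log (u * N) ^ 2 ≤ (Real.log u + Real.log (2 + N)) ^ 2 :=
          pow_le_pow_left₀ (Real.log_nonneg (by linarith)) hlogT 2
      _ ≤ 2 * (Real.log u ^ 2 + Real.log (2 + N) ^ 2) := add_sq_le
      _ ≤ 32 * √u + 2 * Real.log (2 + N) ^ 2 := by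
          linarith [log_sq_le_mul_sqrt (by linarith : 1 ≤ u)]
  have hsqrt_mul : 10 ^ 5 * √u ≤ u :=
    calc 10 ^ 5 * √u ≤ √u * √u := mul_le_mul_of_nonneg_right hsqrt (Real.sqrt_nonneg u)
      _ = u := Real.mul_self_sqrt (by linarith)
  calc 2000 * N * Real.log (u * N) ^ 2 = 2000 * Real.log (u * N) ^ 2 * N := by ring
    _ ≤ u * N := mul_le_mul_of_nonneg_right (by linarith) hN0.le

lemma rate_le_of_sampleSize_le {G L η ε T : ℝ} (hG : 0 ≤ G) (hL : 1 ≤ L) (hη : 0 < η)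
    (hη3 : η ≤ 3) (hε : 0 < ε) (hε1 : ε ≤ 1)
    (hT : 10 ^ 11 * ((1 + G) * L * ε⁻¹ * (η ^ 2)⁻¹)
      * Real.log (2 + (1 + G) * L * ε⁻¹ * (η ^ 2)⁻¹) ^ 2 ≤ T) :
    2 ≤ T ∧ 2000 * L / η ^ 2 * Real.log T ^ 2 ≤ T
      ∧ 11 * G * L / η ^ 2 * (Real.log T ^ 2 / T) ≤ ε := by
  set N := (1 + G) * L * ε⁻¹ * (η ^ 2)⁻¹ with hN
  have hNε : (1 + G) * (L / η ^ 2) = ε * N := by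
    rw [hN]
    field_simp
  have hL0 : 0 ≤ L / η ^ 2 := by positivity
  have hN0 : 0 ≤ N := by positivity
  have hLN : L / η ^ 2 ≤ N :=
    calc L / η ^ 2 ≤ (1 + G) * (L / η ^ 2) := le_mul_of_one_le_left hL0 (by linarith)
      _ = ε * N := hNε
      _ ≤ N := mul_le_of_le_one_left hN0 hε1
  have hN_large : 1 / 9 ≤ N := by
    refine le_trans (div_le_div₀ (by positivity) hL (by positivity) ?_) hLN
    exact (pow_le_pow_left₀ hη.le hη3 2).trans (by norm_num)
  obtain ⟨hTwo, hTlog⟩ := mul_log_sq_le_of_le hN_large hT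
  have hGN : G * (L / η ^ 2) ≤ ε * N := by linarith
  refine ⟨hTwo, ?_, ?_⟩
  · calc 2000 * L / η ^ 2 * Real.log T ^ 2 = 2000 * (L / η ^ 2) * Real.log T ^ 2 := by ring
      _ ≤ 2000 * N * Real.log T ^ 2 := by gcongr
      _ ≤ T := hTlog
  · calc 11 * G * L / η ^ 2 * (Real.log T ^ 2 / T)
        = 11 * (G * (L / η ^ 2)) * Real.log T ^ 2 / T := by ring
      _ ≤ 2000 * (ε * N) * Real.log T ^ 2 / T := by
          gcongr
          norm_num
      _ = ε * (2000 * N * Real.log T ^ 2 / T) := by ring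
      _ ≤ ε := mul_le_of_le_one_right hε.le ((div_le_one (by linarith)).2 hTlog)

variable {d : ℕ} {Ω : Type*} [MeasurableSpace S] [MeasurableSingletonClass S]
  [MeasurableSpace Ω] {Q : Measure Ω} [IsProbabilityMeasure Q] {R : S → ℝ}
  {Φ : Matrix S (Fin d) ℝ} {r η : ℝ} {θstar : EuclideanSpace ℝ (Fin d)}
  {s sHat : ℕ → Ω → S}

lemma meanSqError_log_div_le (hr : 0 ≤ r) (θ₀ : EuclideanSpace ℝ (Fin d))
    (hg : IsDissipativeUpdate (P ⊗ₖ P) (fun z => μ z.1 * μ z.2) (doubleUpdate R Φ) 3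
      (r + ‖θstar‖) η θstar)
    (hη : 0 < η) (hη3 : η ≤ 3) (hP : P ∈ rowStochastic ℝ S) (hμ : IsStationary P μ)
    (hs : IsMarkovChain Q P s) (hsHat : IsMarkovChain Q P sHat)
    (hind : IndepFun (fun ω t => s t ω) (fun ω t => sHat t ω) Q)
    (hmix : IsGeometricMixing P μ C β) {T : ℕ} (hT : 2 ≤ T)
    (hLT : 2000 * mixingFactor C β / η ^ 2 * Real.log T ^ 2 ≤ T) :
    meanSqError Q R Φ (Real.log T / (η * T)) θ₀ θstar s sHat T
      ≤ 11 * constG r θ₀ θstar * mixingFactor C β / η ^ 2 * (Real.log T ^ 2 / T) := by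
  have hT2 : (2 : ℝ) ≤ T := by exact_mod_cast hT
  have hlog := le_log_of_two_le hT2
  have hL := one_le_mixingFactor C β
  have hG := constG_nonneg r θ₀ θstar
  have hα : 0 < Real.log T / (η * T) := by positivity
  have hτ := hmix.mixingTime_log_div_le hη hη3 hT2
  set τ := mixingTime P μ (Real.log T / (η * T))
  have hατ := log_div_mul_le_div hL hη hT2 hτ hLT
  have hτlog := mul_log_le_div hη hη3 hT2 hτ hLT
  have hτT : τ ≤ T := by
    have hτ0 := mul_le_mul_of_nonneg_left hlog (Nat.cast_nonneg (α := ℝ) τ)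
    exact_mod_cast (by linarith : (τ : ℝ) ≤ T)
  have hαB : Real.log T / (η * T) * (3 * τ + 1) * constG r θ₀ θstar
      ≤ η * constB r θ₀ θstar ^ 2 := by
    have hηB : 0 ≤ η * constB r θ₀ θstar ^ 2 := by positivity
    linarith [mul_le_mul hατ (constG_le θ₀ θstar hr) hG (by positivity)]
  exact (meanSqError_le θ₀ hg hη hη3 hP hμ hs hsHat hind hα (hmix.l1Dist_mixingTime_le hα)
    (by linarith) hαB hτT).trans (exp_mul_add_le_rate hG (mul_constB_sq_le_constG r θ₀ θstar)
      hL hη hη3 hT2 hτ (by linarith))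

end Rate

end AvgRewardTD

end

open AvgRewardTD in
theorem theorem2 :
    -- an absolute constant, used only for the rate and the sample complexity
    ∃ K : ℝ, 0 < K ∧
    ∀ (S A : Type*) [Fintype S] [DecidableEq S] [MeasurableSpace S] [MeasurableSingletonClass S]
      [Fintype A] (M : MDP S A) (π : Policy S A)
      (_ : (M.transMatrix π).IsIrreducible) (_ : IsAperiodic (M.transMatrix π))
      (μ : S → ℝ) (_ : IsStationary (M.transMatrix π) μ)
      (d : ℕ) (_ : 0 < d) (Φ : Matrix S (Fin d) ℝ)
      (_ : ∀ s, ‖feature Φ s‖ ≤ 1) (_ : LinearIndependent ℝ Φ.col)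
      (θstar : EuclideanSpace ℝ (Fin d))
      (_ : IsFixedPoint (M.transMatrix π) μ (M.expReward π) Φ θstar)
      (θ₀ : EuclideanSpace ℝ (Fin d))
      (Ω : Type*) [MeasurableSpace Ω] (Q : Measure Ω) [IsProbabilityMeasure Q]
      (s sHat : ℕ → Ω → S)
      (_ : IsMarkovChain Q (M.transMatrix π) s) (_ : IsMarkovChain Q (M.transMatrix π) sHat)
      (_ : IndepFun (fun ω t => s t ω) (fun ω t => sHat t ω) Q),
      let P := M.transMatrix π
      let η := conditionNumber P μ Φ
      let B := constB M.rMax θ₀ θstar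
      let G := constG M.rMax θ₀ θstar
      let err := fun (α : ℝ) (T : ℕ) =>
        meanSqError Q (M.expReward π) Φ α θ₀ θstar s sHat T
      -- the finite-time bound
      (∀ α : ℝ, 0 < α →
        α ≤ η * B ^ 2 / ((3 * (mixingTime P μ α : ℝ) + 1) * G) →
        ∀ T : ℕ, mixingTime P μ α ≤ T →
          err α T ≤ Real.exp (-2 * α * η * ((T : ℝ) - mixingTime P μ α)) * B ^ 2
            + α * G * (3 * (mixingTime P μ α : ℝ) + 1) / (2 * η)) ∧
      -- the chain mixes geometrically
      (∃ C β : ℝ, IsGeometricMixing P μ C β) ∧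
      -- for the stepsize `log T / (η T)`: rate and sample complexity
      (∀ C β : ℝ, IsGeometricMixing P μ C β →
        let L := mixingFactor C β
        (∀ T : ℕ, 2 ≤ T → K * L / η ^ 2 * Real.log T ^ 2 ≤ T →
          err (Real.log T / (η * T)) T ≤ K * G * L / η ^ 2 * (Real.log T ^ 2 / T)) ∧
        (∀ ε : ℝ, 0 < ε → ε ≤ 1 →
          let N := (1 + G) * L * ε⁻¹ * (η ^ 2)⁻¹
          ∀ T : ℕ, K * N * Real.log (2 + N) ^ 2 ≤ T →
            err (Real.log T / (η * T)) T ≤ ε)) := by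
  refine ⟨10 ^ 11, by norm_num, ?_⟩
  intro S A _ _ _ _ _ M π hirr hap μ hμ d hd Φ hΦ hΦi θstar hθ θ₀ Ω _ Q _ s sHat hs hsHat hind
    P η B G err
  have hP := M.transMatrix_mem_rowStochastic π
  have hη : 0 < η := conditionNumber_pos hμ hirr hΦi hd
  have hg := isDissipativeUpdate_doubleUpdate hP hμ hΦ M.rMax_nonneg (M.abs_expReward_le π) hθ
  have : Nonempty (Fin d) := ⟨⟨0, hd⟩⟩
  have hη3 : η ≤ 3 :=
    hg.rate_le_lipschitz (kronecker_mem_rowStochastic hP hP) (mul_mem_stdSimplex hμ.1 hμ.1)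
  have hG : 0 ≤ G := constG_nonneg _ _ _
  have hgeo := exists_isGeometricMixing hP (hap.isPrimitive hirr) hμ
  refine ⟨fun α hα hα_le T hT => ?_, hgeo, fun C β hmix => ?_⟩
  · obtain ⟨C, β, hmix⟩ := hgeo
    exact meanSqError_le_of_le_div θ₀ hg hη hη3 hP hμ hs hsHat hind hα
      (hmix.l1Dist_mixingTime_le hα) hα_le hT
  intro L
  have hL : 1 ≤ L := one_le_mixingFactor C β
  have hrate {T : ℕ} := meanSqError_log_div_le (T := T) M.rMax_nonneg θ₀ hg hη hη3 hP hμ hs hsHat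
    hind hmix
  refine ⟨fun T hT hLT => ?_, fun ε hε hε1 => ?_⟩
  · exact (hrate hT (hLT.trans' (by gcongr; norm_num))).trans (by gcongr; norm_num)
  · intro N T hNT
    obtain ⟨hT, hLT, hle⟩ := rate_le_of_sampleSize_le hG hL hη hη3 hε hε1 hNT
    exact (hrate (by exact_mod_cast hT) hLT).trans hle
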